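/- Let $N\ge 1$ be an integer and $0<s<1$ with $N>2s$, and put $2_s^*=\frac{2N}{N-2s}$. All functions are real-valued. With $\mathcal F u(\xi)=\int_{\mathbb R^N}u(x)e^{-2\pi i\xi\cdot x}\,dx$ (extended to $L^2$), let $(-\Delta)^{s/2}u=\mathcal F^{-1}(|2\pi\xi|^{s}\mathcal Fu)$ and $$H^s(\mathbb R^N)=\{u\in L^2(\mathbb R^N):\ \mathcal F^{-1}[(1+|2\pi\xi|^{2s})^{1/2}\mathcal Fu]\in L^2(\mathbb R^N)\},$$ $$H^s_0(\Omega)=\{u\in H^s(\mathbb R^N):\ u=0\text{ a.e. in }\mathbb R^N\setminus\Omega\}.$$ Let $D^{s,2}(\mathbb R^N)$ be the completion of $C_c^\infty(\mathbb R^N)$ with respect to $\|(-\Delta)^{s/2}u\|_{L^2(\mathbb R^N)}$, regarded as a space of functions in $L^{2_s^*}(\mathbb R^N)$, and define $$\mathcal S_s=\inf_{u\in D^{s,2}(\mathbb R^N)\setminus\{0\}}\frac{\|(-\Delta)^{s/2}u\|_{L^2(\mathbb R^N)}^2}{\|u\|_{L^{2_s^*}(\mathbb R^N)}^2},\qquad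 S_{s,q}(\Omega)=\inf_{u\in H^s_0(\Omega)\setminus\{0\}}\frac{\|(-\Delta)^{s/2}u\|_{L^2(\mathbb R^N)}^2}{\|u\|_{L^q(\Omega)}^2},$$ $$S_{s,q}(\mathbb R^N)=\inf_{u\in H^s(\mathbb R^N)\setminus\{0\}}\frac{\|(-\Delta)^{s/2}u\|_{L^2(\mathbb R^N)}^2+\|u\|_{L^2(\mathbb R^N)}^2}{\|u\|_{L^q(\mathbb R^N)}^2}.$$ Let $\omega_N$ be the volume of the unit ball of $\mathbb R^N$, $\mathrm B$ the Beta function, $|\Omega|$ the Lebesgue measure of $\Omega$, and $R_\Omega=\sup\{R>0:\ B_R(x)\subset\Omega\text{ for some }x\in\Omega\}$. (1) For every nonempty bounded open set $\Omega\subset\mathbb R^N$ (in particular every bounded smooth domain) and every real $q$ with $1\le q<2_s^*$, $$\mathcal S_s|\Omega|^{2\left(\frac1{2_s^*}-\frac1q\right)}\le S_{s,q}(\Omega)\le\frac{2^{2s+\frac2q}(\omega_NN)^{1-\frac2q}}{N+2s}\,\Gamma(s+1)^2\left[\mathrm B\left(\tfrac N2,qs+1\right)\right]^{-\frac2q}R_\Omega^{2N\left(\frac1{2_s^*}-\frac1q\right)}.$$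 (2) $S_{s,2}(\mathbb R^N)=1$. (3) For every real $q$ with $2<q<2_s^*$, $$\left[\tfrac Ns\left(\tfrac1q-\tfrac1{2_s^*}\right)\right]^{\frac Ns\left(\frac1{2_s^*}-\frac1q\right)}\left[\tfrac Ns\left(\tfrac12-\tfrac1q\right)\right]^{\frac Ns\left(\frac1q-\frac12\right)}\mathcal S_s^{\frac Ns\left(\frac12-\frac1q\right)}\le S_{s,q}(\mathbb R^N)$$ and $$S_{s,q}(\mathbb R^N)\le\omega_N^{1-\frac2q}\,s\left[\frac{2^{2s+1-\frac{2s}N}\,\Gamma(s+1)^2}{(N+2s)\left(\frac12-\frac1q\right)}\right]^{\frac Ns\left(\frac12-\frac1q\right)}\left[N\,\mathrm B\left(\tfrac N2,qs+1\right)\right]^{-\frac2q}\left[\frac{\mathrm B\left(\frac N2,2s+1\right)}{\frac1q-\frac1{2_s^*}}\right]^{\frac Ns\left(\frac1q-\frac1{2_s^*}\right)}.$$ -/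

import Mathlib

namespace FracSobolev

open MeasureTheory Filter
open scoped FourierTransform Topology ENNReal ContDiff

/-- `ℝ^N` with its Euclidean norm and Lebesgue measure. -/
abbrev Space (N : ℕ) : Type := EuclideanSpace ℝ (Fin N)

variable {N : ℕ}

/-- The Fourier transform on `L²(ℝ^N)`, with the normalisation
`𝓕 u (ξ) = ∫ u(x) exp(-2πi ξ·x) dx`, of (the class of) a real function `u ∈ L²(ℝ^N)`
(and `0` if `u ∉ L²`). -/
noncomputable def l2Fourier (u : Space N → ℝ) : Lp ℂ 2 (volume : Measure (Space N)) :=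
  open Classical in
  if h : MemLp (fun x => (u x : ℂ)) 2 volume then 𝓕 (h.toLp (fun x => (u x : ℂ))) else 0

/-- The multiplier side of the fractional Laplacian: `ξ ↦ |2πξ|^{2σ} 𝓕u(ξ)`. -/
noncomputable def fracLapSymbol (σ : ℝ) (u : Space N → ℝ) (ξ : Space N) : ℂ :=
  (((‖(2 * Real.pi) • ξ‖ ^ (2 * σ) : ℝ)) : ℂ) * l2Fourier u ξ

/-- The fractional Laplacian `(-Δ)^σ u = 𝓕⁻¹(|2πξ|^{2σ} 𝓕u)` as an element of `L²(ℝ^N)`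
(`0` if `|2πξ|^{2σ} 𝓕u ∉ L²`; this does not happen for `u ∈ H^s`, `σ = s / 2`). -/
noncomputable def fracLap (σ : ℝ) (u : Space N → ℝ) : Lp ℂ 2 (volume : Measure (Space N)) :=
  open Classical in
  if h : MemLp (fracLapSymbol σ u) 2 volume then 𝓕⁻ (h.toLp (fracLapSymbol σ u)) else 0

/-- `u ∈ H^s(ℝ^N)`: `u ∈ L²` and `𝓕⁻¹[(1 + |2πξ|^{2s})^{1/2} 𝓕u] ∈ L²`; as `𝓕` is a unitary map
of `L²`, the latter says `(1 + |2πξ|^{2s})^{1/2} 𝓕u ∈ L²`. -/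
def MemHs (s : ℝ) (u : Space N → ℝ) : Prop :=
  MemLp u 2 volume ∧
    MemLp (fun ξ => ((((1 + ‖(2 * Real.pi) • ξ‖ ^ (2 * s)) ^ (1 / 2 : ℝ) : ℝ)) : ℂ)
      * l2Fourier u ξ) 2 volume

/-- `u ∈ H^s_0(Ω)`: `u ∈ H^s(ℝ^N)` and `u = 0` almost everywhere outside `Ω`. -/
def MemHs0 (s : ℝ) (Ω : Set (Space N)) (u : Space N → ℝ) : Prop :=
  MemHs s u ∧ ∀ᵐ x ∂(volume : Measure (Space N)), x ∉ Ω → u x = 0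

/-- The critical exponent `2_s^* = 2N / (N - 2s)`. -/
noncomputable def critExp (N : ℕ) (s : ℝ) : ℝ := 2 * N / (N - 2 * s)

/-- `u` belongs to `D^{s,2}(ℝ^N)`, the completion of `C_c^∞(ℝ^N)` in the norm
`‖(-Δ)^{s/2} φ‖_{L²}`, realised as a space of functions in `L^{2_s^*}`, and
`w = (-Δ)^{s/2} u` in that completion: some sequence of test functions `φ n` is Cauchy in this
norm, with `(-Δ)^{s/2} φ n → w` in `L²`, and converges to `u` in `L^{2_s^*}`. -/
def IsDsLimit (s : ℝ) (u : Space N → ℝ) (w : Lp ℂ 2 (volume : Measure (Space N))) : Prop :=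
  MemLp u (ENNReal.ofReal (critExp N s)) volume ∧
  ∃ φ : ℕ → Space N → ℝ,
    (∀ n, ContDiff ℝ ∞ (φ n) ∧ HasCompactSupport (φ n)) ∧
    Tendsto (fun n => eLpNorm (φ n - u) (ENNReal.ofReal (critExp N s)) volume) atTop (𝓝 0) ∧
    Tendsto (fun n => fracLap (s / 2) (φ n)) atTop (𝓝 w)

/-- The critical Sobolev constant `𝒮_s`, the infimum of
`‖(-Δ)^{s/2} u‖²_{L²(ℝ^N)} / ‖u‖²_{L^{2_s^*}(ℝ^N)}` over `u ∈ D^{s,2}(ℝ^N) \ {0}`. -/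
noncomputable def sobolevConst (N : ℕ) (s : ℝ) : ℝ :=
  sInf {r : ℝ | ∃ (u : Space N → ℝ) (w : Lp ℂ 2 (volume : Measure (Space N))),
    IsDsLimit s u w ∧ ¬ u =ᵐ[volume] 0 ∧
    r = ‖w‖ ^ 2 / lpNorm u (ENNReal.ofReal (critExp N s)) volume ^ 2}

/-- `S_{s,q}(Ω)`, the infimum of `‖(-Δ)^{s/2} u‖²_{L²(ℝ^N)} / ‖u‖²_{L^q(Ω)}` over
`u ∈ H^s_0(Ω) \ {0}`. -/
noncomputable def domainConst (s q : ℝ) (Ω : Set (Space N)) : ℝ :=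
  sInf {r : ℝ | ∃ u : Space N → ℝ, MemHs0 s Ω u ∧ ¬ u =ᵐ[volume] 0 ∧
    r = ‖fracLap (s / 2) u‖ ^ 2 / lpNorm u (ENNReal.ofReal q) (volume.restrict Ω) ^ 2}

/-- `S_{s,q}(ℝ^N)`, the infimum of
`(‖(-Δ)^{s/2} u‖²_{L²(ℝ^N)} + ‖u‖²_{L²(ℝ^N)}) / ‖u‖²_{L^q(ℝ^N)}` over `u ∈ H^s(ℝ^N) \ {0}`. -/
noncomputable def wholeSpaceConst (N : ℕ) (s q : ℝ) : ℝ :=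
  sInf {r : ℝ | ∃ u : Space N → ℝ, MemHs s u ∧ ¬ u =ᵐ[volume] 0 ∧
    r = (‖fracLap (s / 2) u‖ ^ 2 + lpNorm u 2 volume ^ 2)
      / lpNorm u (ENNReal.ofReal q) volume ^ 2}

/-- `R_Ω`, the largest radius of a ball contained in `Ω`. -/
noncomputable def inradius (Ω : Set (Space N)) : ℝ :=
  sSup {R : ℝ | 0 < R ∧ ∃ x ∈ Ω, Metric.ball x R ⊆ Ω}

/-- `ω_N`, the volume of the unit ball of `ℝ^N`. -/
noncomputable def unitBallVol (N : ℕ) : ℝ := volume.real (Metric.ball (0 : Space N) 1)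

end FracSobolev

namespace FracSobolev

open MeasureTheory Filter
open scoped FourierTransform Topology ENNReal ContDiff SchwartzMap LineDeriv

variable {N : ℕ}

/-! Upper bounds. All of them come from the competitors v = (R² - |x - x₀|²)₊^s (`bump`), which up
to a factor are the torsion functions of (-Δ)^s on balls. Their L^q norms are Beta integrals. Their
energy is bounded without differentiating v. For a profile p on [0, ∞) put g(x) = s ∫₀^∞ σ^{s-1}
p(|x|² + σ) dσ. If p is a combination of exponentials e^{-mτ}, then g is a combination of Gaussians,
and an explicit Fourier computation gives ∫ |2πξ|^{2s} |𝓕g|² = K ∫₀^∞ p(τ)² τ^{s+N/2-1} dτ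
(`fourierEnergy_gaussPoly`). The bump corresponds to p = 1_{[0,R²)}. Approximating this indicator by
polynomials in e^{-τ} and using Fatou's lemma in ξ gives the required upper estimate
(`fourierEnergy_bump_zero_le`). On Ω the radius R tends to the inradius. On ℝ^N the quotient is a
sum of two powers of R, and R is optimised (`exists_optimal_radius`); for q = 2 the radius tends to
infinity.

Lower bounds. They rest on the critical inequality 𝒮_s ‖u‖²_{2_s^*} ≤ ‖(-Δ)^{s/2}u‖² for u in H^s
(`sobolev_memHs`). For test functions it is the definition of 𝒮_s. For general u, test functions are
found that converge to u in L² with energies asymptotically no larger than that of u, and Fatou's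
lemma yields the inequality (`exists_testFunction_near`, `eLpNorm_le_of_approx`). Hölder's
inequality on Ω then gives (1). Interpolation of L^q between L² and L^{2_s^*}, followed by the
weighted AM-GM inequality, gives (3). Positivity of 𝒮_s is never needed: if 𝒮_s = 0, the lower
bounds are trivial. -/

/-! ### The L² Fourier transform and membership in H^s -/

/-- Both transforms move onto the other factor when paired with a smooth compactly supported
function: one as a tempered distribution, the other by Fubini. Hence they have equal integrals
against every such function. -/
theorem fourier_toLp_ae_eq {f : Space N → ℂ} (h1 : Integrable f) (h2 : MemLp f 2 volume) :
    (𝓕 (h2.toLp f) : Lp ℂ 2 (volume : Measure (Space N))) =ᵐ[volume] 𝓕 f := by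
  have hloc : LocallyIntegrable (𝓕 (h2.toLp f) : Lp ℂ 2 (volume : Measure (Space N))) volume :=
    (Lp.memLp _).locallyIntegrable (by norm_num)
  have hcont : Continuous (𝓕 f) :=
    VectorFourier.fourierIntegral_continuous Real.continuous_fourierChar continuous_inner h1
  refine ae_eq_of_integral_contDiff_smul_eq hloc hcont.locallyIntegrable fun g hg hgc => ?_
  have hgc' : HasCompactSupport (fun x => (g x : ℂ)) := hgc.comp_left (g := Complex.ofReal) (by simp)
  have hg' : ContDiff ℝ ∞ (fun x => (g x : ℂ)) := Complex.ofRealCLM.contDiff.comp hg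
  set G : 𝓢(Space N, ℂ) := hgc'.toSchwartzMap hg' with hG
  have key := congrArg (fun T => T G) (Lp.fourier_toTemperedDistribution_eq (h2.toLp f))
  simp only [TemperedDistribution.fourier_apply, Lp.toTemperedDistribution_apply] at key
  have e1 : ∫ x, g x • (𝓕 (h2.toLp f) : Lp ℂ 2 (volume : Measure (Space N))) x
      = ∫ x, G x • (𝓕 (h2.toLp f) : Lp ℂ 2 (volume : Measure (Space N))) x := by
    congr 1
  rw [e1, ← key]
  have e2 : ∫ x, (𝓕 G) x • (h2.toLp f) x = ∫ x, (𝓕 G) x • f x := by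
    refine integral_congr_ae ?_
    filter_upwards [h2.coeFn_toLp] with x hx
    rw [hx]
  rw [e2]
  have := VectorFourier.integral_fourierIntegral_smul_eq_flip (μ := volume) (ν := volume) (L := innerₗ (Space N))
    Real.continuous_fourierChar continuous_inner G.integrable h1
  rw [flip_innerₗ] at this
  exact this

theorem l2Fourier_ae_eq {u : Space N → ℝ} (h1 : Integrable u) (h2 : MemLp u 2 volume) :
    l2Fourier u =ᵐ[volume] 𝓕 (fun x => (u x : ℂ)) := by
  have h : MemLp (fun x => (u x : ℂ)) 2 volume := h2.ofReal
  rw [l2Fourier, dif_pos h]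
  exact fourier_toLp_ae_eq h1.ofReal h

theorem norm_fracLap {σ : ℝ} {u : Space N → ℝ} (h : MemLp (fracLapSymbol σ u) 2 volume) :
    ‖fracLap σ u‖ = (eLpNorm (fracLapSymbol σ u) 2 volume).toReal := by
  have e : ∀ g : Lp ℂ 2 (volume : Measure (Space N)), ‖(𝓕⁻ g : Lp ℂ 2 volume)‖ = ‖g‖ := fun g => by
    rw [← Lp.norm_fourier_eq (𝓕⁻ g), FourierTransform.fourier_fourierInv_eq]
  rw [fracLap, dif_pos h, e, Lp.norm_toLp]

/-- With t = |2πξ|^s, this is t ≤ √(1 + t²); the converse below uses √(1 + t²) ≤ 1 + t. -/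
theorem MemHs.memLp_symbol {s : ℝ} {u : Space N → ℝ} (h : MemHs s u) :
    MemLp (fracLapSymbol (s / 2) u) 2 volume := by
  refine h.2.mono ?_ (ae_of_all _ fun ξ => ?_)
  · refine AEStronglyMeasurable.mul ?_ (Lp.aestronglyMeasurable _)
    exact (Measurable.aestronglyMeasurable (by fun_prop))
  · rw [fracLapSymbol, norm_mul, norm_mul]
    gcongr
    rw [Complex.norm_real, Complex.norm_real, Real.norm_of_nonneg (by positivity), Real.norm_of_nonneg (by positivity)]
    have : ‖(2 * Real.pi) • ξ‖ ^ (2 * (s / 2)) = (‖(2 * Real.pi) • ξ‖ ^ (2 * s)) ^ (1 / 2 : ℝ) := by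
      rw [← Real.rpow_mul (norm_nonneg _)]; ring_nf
    rw [this]
    exact Real.rpow_le_rpow (by positivity) (by linarith) (by norm_num)

theorem MemHs.of_memLp_symbol {s : ℝ} {u : Space N → ℝ} (hu : MemLp u 2 volume)
    (h : MemLp (fracLapSymbol (s / 2) u) 2 volume) : MemHs s u := by
  refine ⟨hu, ((Lp.memLp (l2Fourier u)).norm.add h.norm).mono ?_ (ae_of_all _ fun ξ => ?_)⟩
  · refine AEStronglyMeasurable.mul ?_ (Lp.aestronglyMeasurable _)
    exact (Measurable.aestronglyMeasurable (by fun_prop))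
  · simp only [Pi.add_apply]
    rw [Real.norm_of_nonneg (by positivity), fracLapSymbol, norm_mul, norm_mul, ← one_add_mul]
    gcongr
    rw [Complex.norm_real, Complex.norm_real, Real.norm_of_nonneg (by positivity), Real.norm_of_nonneg (by positivity)]
    set t := ‖(2 * Real.pi) • ξ‖ ^ (2 * (s / 2)) with ht
    have ht0 : 0 ≤ t := by positivity
    have : ‖(2 * Real.pi) • ξ‖ ^ (2 * s) = t ^ 2 := by
      rw [ht, ← Real.rpow_natCast, ← Real.rpow_mul (norm_nonneg _)]; push_cast; ring_nf
    rw [this, ← Real.sqrt_eq_rpow]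
    exact Real.sqrt_le_iff.2 ⟨by positivity, by nlinarith⟩

/-! ### Gaussian moments in ℝ^N -/

theorem integral_rpow_norm_mul_exp (hN : 0 < N) {s b : ℝ} (hs : 0 < s) (hb : 0 < b) :
    ∫ ξ : Space N, ‖ξ‖ ^ (2 * s) * Real.exp (-b * ‖ξ‖ ^ 2)
      = N * unitBallVol N / 2 * Real.Gamma (s + N / 2) * b ^ (-(s + N / 2)) := by
  have : Nontrivial (Space N) := by
    have : Nonempty (Fin N) := ⟨⟨0, hN⟩⟩
    infer_instance
  have h1 := integral_fun_norm_addHaar (volume : Measure (Space N))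
    (fun r : ℝ => r ^ (2 * s) * Real.exp (-b * r ^ 2))
  rw [h1]
  have hN1 : (1 : ℝ) ≤ N := by exact_mod_cast hN
  have h2 : ∫ y in Set.Ioi (0 : ℝ), y ^ (Module.finrank ℝ (Space N) - 1)
        • (y ^ (2 * s) * Real.exp (-b * y ^ 2))
      = ∫ y in Set.Ioi (0 : ℝ), y ^ (2 * s + N - 1) * Real.exp (-b * y ^ (2 : ℝ)) := by
    refine setIntegral_congr_fun measurableSet_Ioi fun y hy => ?_
    have hy : 0 < y := hy
    simp only [finrank_euclideanSpace, Fintype.card_fin, smul_eq_mul]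
    rw [← mul_assoc, ← Real.rpow_natCast y (N - 1), ← Real.rpow_add hy, Nat.cast_sub hN]
    norm_num
    ring_nf
  rw [h2, integral_rpow_mul_exp_neg_mul_rpow (by norm_num) (by linarith) hb]
  simp only [finrank_euclideanSpace, Fintype.card_fin, smul_eq_mul, nsmul_eq_mul, unitBallVol]
  rw [show -(2 * s + N - 1 + 1) / 2 = -(s + N / 2) by ring, show (2 * s + N - 1 + 1) / 2 = s + N / 2 by ring]
  ring

theorem integrable_rpow_norm_mul_exp (hN : 0 < N) {s b : ℝ} (hs : 0 < s) (hb : 0 < b) :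
    Integrable (fun ξ : Space N => ‖ξ‖ ^ (2 * s) * Real.exp (-b * ‖ξ‖ ^ 2)) := by
  -- A non-integrable function has Bochner integral 0, so the positive value just computed forces
  -- integrability.
  refine .of_integral_ne_zero ?_
  rw [integral_rpow_norm_mul_exp hN hs hb]
  have : 0 < unitBallVol N := by
    rw [unitBallVol]
    exact ENNReal.toReal_pos (Metric.measure_ball_pos _ _ one_pos).ne' measure_ball_lt_top.ne
  have := Real.Gamma_pos_of_pos (show 0 < s + N / 2 by positivity)
  have hN' : (0 : ℝ) < N := by exact_mod_cast hN
  positivity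

/-! ### Superpositions of Gaussians and their exact energy -/

/-- `τ ↦ e^{-τ} P(e^{-τ})`. -/
noncomputable def expPoly (P : Polynomial ℝ) (τ : ℝ) : ℝ := Real.exp (-τ) * P.eval (Real.exp (-τ))

/-- The combination of Gaussians `x ↦ s ∫₀^∞ σ^{s-1} p(|x|² + σ) dσ`, where `p = expPoly P`. -/
noncomputable def gaussPoly (s : ℝ) (P : Polynomial ℝ) (x : Space N) : ℝ :=
  ∑ i ∈ Finset.range (P.natDegree + 1),
    P.coeff i * (Real.Gamma (s + 1) * (i + 1 : ℝ) ^ (-s)) * Real.exp (-(i + 1) * ‖x‖ ^ 2)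

theorem expPoly_eq_sum (P : Polynomial ℝ) (τ : ℝ) :
    expPoly P τ = ∑ i ∈ Finset.range (P.natDegree + 1), P.coeff i * Real.exp (-((i + 1) * τ)) := by
  rw [expPoly, Polynomial.eval_eq_sum_range, Finset.mul_sum]
  refine Finset.sum_congr rfl fun i _ => ?_
  rw [← Real.exp_nat_mul, mul_left_comm, ← Real.exp_add]
  ring_nf

theorem continuous_expPoly (P : Polynomial ℝ) : Continuous (expPoly P) := by
  unfold expPoly; fun_prop

theorem continuous_gaussPoly (s : ℝ) (P : Polynomial ℝ) :
    Continuous (gaussPoly (N := N) s P) := by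
  unfold gaussPoly; fun_prop

theorem integrable_exp_norm_sq {b : ℝ} (hb : 0 < b) :
    Integrable (fun x : Space N => Real.exp (-b * ‖x‖ ^ 2)) := by
  have := GaussianFourier.integrable_cexp_neg_mul_sq_norm_add (V := Space N) (b := b) (by simpa using hb) 0 0
  refine this.norm.congr (ae_of_all _ fun x => ?_)
  simp [Complex.norm_exp, ← Complex.ofReal_pow, ← Complex.ofReal_mul, -Complex.ofReal_neg]

theorem integral_rpow_mul_exp_neg {a m : ℝ} (ha : 0 < a) (hm : 0 < m) :
    ∫ σ in Set.Ioi (0 : ℝ), σ ^ (a - 1) * Real.exp (-(m * σ)) = Real.Gamma a * m ^ (-a) := by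
  rw [Real.integral_rpow_mul_exp_neg_mul_Ioi ha hm, one_div, Real.inv_rpow hm.le, Real.rpow_neg hm.le]
  ring

theorem integrableOn_rpow_mul_exp_neg {a m : ℝ} (ha : 0 < a) (hm : 0 < m) :
    IntegrableOn (fun σ : ℝ => σ ^ (a - 1) * Real.exp (-(m * σ))) (Set.Ioi 0) := by
  refine Integrable.of_integral_ne_zero ?_
  rw [integral_rpow_mul_exp_neg ha hm]
  have := Real.Gamma_pos_of_pos ha
  positivity

/-- Termwise this is Γ(s) m^{-s} = ∫₀^∞ σ^{s-1} e^{-mσ} dσ with m = i + 1. The factor e^{-τ} in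
`expPoly` keeps m positive, so every Gaussian decays. -/
theorem gaussPoly_eq_integral {s : ℝ} (hs : 0 < s) (P : Polynomial ℝ) (x : Space N) :
    gaussPoly s P x = s * ∫ σ in Set.Ioi (0 : ℝ), σ ^ (s - 1) * expPoly P (‖x‖ ^ 2 + σ) := by
  have h1 : ∀ σ : ℝ, σ ^ (s - 1) * expPoly P (‖x‖ ^ 2 + σ)
      = ∑ i ∈ Finset.range (P.natDegree + 1), (P.coeff i * Real.exp (-(i + 1) * ‖x‖ ^ 2))
          * (σ ^ (s - 1) * Real.exp (-((i + 1) * σ))) := by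
    intro σ
    rw [expPoly_eq_sum, Finset.mul_sum]
    refine Finset.sum_congr rfl fun i _ => ?_
    rw [mul_add, neg_add, Real.exp_add]
    ring_nf
  simp_rw [h1]
  rw [integral_finsetSum _ fun i _ => (integrableOn_rpow_mul_exp_neg hs (by positivity)).const_mul _,
    gaussPoly, Finset.mul_sum]
  refine Finset.sum_congr rfl fun i _ => ?_
  rw [integral_const_mul, integral_rpow_mul_exp_neg hs (by positivity), Real.Gamma_add_one hs.ne']
  ring

theorem fourier_gaussPoly (s : ℝ) (P : Polynomial ℝ) (ξ : Space N) :
    𝓕 (fun x : Space N => (gaussPoly s P x : ℂ)) ξ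
      = ((∑ i ∈ Finset.range (P.natDegree + 1),
          P.coeff i * (Real.Gamma (s + 1) * (i + 1 : ℝ) ^ (-s)) * (Real.pi / (i + 1)) ^ (N / 2 : ℝ)
            * Real.exp (-(Real.pi ^ 2 / (i + 1)) * ‖ξ‖ ^ 2) : ℝ) : ℂ) := by
  have hG : ∀ i : ℕ, 𝓕 (fun x : Space N => ((Real.exp (-(i + 1) * ‖x‖ ^ 2) : ℝ) : ℂ)) ξ
      = (((Real.pi / (i + 1)) ^ (N / 2 : ℝ) * Real.exp (-(Real.pi ^ 2 / (i + 1)) * ‖ξ‖ ^ 2) : ℝ) : ℂ) := by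
    intro i
    have h := fourier_gaussian_innerProductSpace (V := Space N) (b := ((i : ℂ) + 1))
      (by simp; positivity) ξ
    push_cast
    rw [h, Complex.ofReal_cpow (by positivity)]
    simp only [finrank_euclideanSpace, Fintype.card_fin]
    push_cast
    congr 2
    ring
  rw [Real.fourier_eq]
  have h2 : ∀ x : Space N, Real.fourierChar (-inner ℝ x ξ) • ((gaussPoly s P x : ℝ) : ℂ)
      = ∑ i ∈ Finset.range (P.natDegree + 1),
        ((P.coeff i * (Real.Gamma (s + 1) * (i + 1 : ℝ) ^ (-s)) : ℝ) : ℂ) *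
          (Real.fourierChar (-inner ℝ x ξ) • ((Real.exp (-(i + 1) * ‖x‖ ^ 2) : ℝ) : ℂ)) := by
    intro x
    rw [gaussPoly]
    simp only [Circle.smul_def, smul_eq_mul]
    push_cast
    rw [Finset.mul_sum]
    refine Finset.sum_congr rfl fun i _ => ?_
    ring
  simp_rw [h2]
  rw [integral_finsetSum]
  · rw [Complex.ofReal_sum]
    refine Finset.sum_congr rfl fun i _ => ?_
    have := hG i
    rw [Real.fourier_eq] at this
    rw [integral_const_mul, this]
    push_cast
    ring
  · intro i _
    refine Integrable.const_mul ?_ _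
    exact (Real.fourierIntegral_convergent_iff ξ).2 ((integrable_exp_norm_sq (by positivity)).ofReal)

theorem unitBallVol_pos : 0 < unitBallVol N :=
  ENNReal.toReal_pos (Metric.measure_ball_pos _ _ one_pos).ne' measure_ball_lt_top.ne

/-- `∫ |2πξ|^{2s} |𝓕 f(ξ)|² dξ`. -/
noncomputable def fourierEnergy (s : ℝ) (f : Space N → ℂ) : ℝ≥0∞ :=
  ∫⁻ ξ, ENNReal.ofReal (‖(2 * Real.pi) • ξ‖ ^ (2 * s) * ‖𝓕 f ξ‖ ^ 2)

theorem norm_two_pi_smul_rpow (s : ℝ) (ξ : Space N) :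
    ‖(2 * Real.pi) • ξ‖ ^ (2 * s) = (2 * Real.pi) ^ (2 * s) * ‖ξ‖ ^ (2 * s) := by
  rw [norm_smul, Real.norm_of_nonneg (by positivity), Real.mul_rpow (by positivity) (by positivity)]

/-- Since 1/m + 1/k = (m + k)/(mk), the weights m^{-s} k^{-s} cancel exactly what the Gaussian
transforms produce. Only a power of m + k remains, which is why the energy becomes a one-dimensional
integral of p². -/
theorem rpow_gaussian_constants {s d m k : ℝ} (hm : 0 < m) (hk : 0 < k) :
    (2 * Real.pi) ^ (2 * s) * (m ^ (-s) * k ^ (-s)) * ((Real.pi / m) ^ (d / 2) * (Real.pi / k) ^ (d / 2))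
      * (Real.pi ^ 2 / m + Real.pi ^ 2 / k) ^ (-(s + d / 2)) = 2 ^ (2 * s) * (m + k) ^ (-(s + d / 2)) := by
  have hpi := Real.pi_pos
  have e : Real.pi ^ 2 / m + Real.pi ^ 2 / k = Real.pi ^ (2 : ℝ) * (m + k) * (m * k)⁻¹ := by
    rw [Real.rpow_two]; field_simp; ring
  rw [e, Real.mul_rpow (x := Real.pi ^ (2 : ℝ) * (m + k)) (by positivity) (by positivity),
    Real.mul_rpow (x := Real.pi ^ (2 : ℝ)) (by positivity) (by positivity),
    Real.inv_rpow (by positivity), ← Real.rpow_mul hpi.le, Real.mul_rpow (by norm_num) hpi.le,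
    Real.mul_rpow hm.le hk.le, Real.div_rpow hpi.le hm.le, Real.div_rpow hpi.le hk.le]
  have h1 : Real.pi ^ (2 * -(s + d / 2)) = (Real.pi ^ (2 * s))⁻¹ * (Real.pi ^ (d / 2))⁻¹ * (Real.pi ^ (d / 2))⁻¹ := by
    rw [← Real.rpow_neg hpi.le, ← Real.rpow_neg hpi.le, ← Real.rpow_add hpi, ← Real.rpow_add hpi]
    ring_nf
  have h2 : ∀ t : ℝ, 0 < t → t ^ (-(s + d / 2)) = t ^ (-s) * (t ^ (d / 2))⁻¹ := fun t ht => by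
    rw [← Real.rpow_neg ht.le, ← Real.rpow_add ht]; ring_nf
  rw [h1, h2 m hm, h2 k hk]
  have := Real.rpow_pos_of_pos hm (-s)
  have := Real.rpow_pos_of_pos hk (-s)
  have := Real.rpow_pos_of_pos hm (d / 2)
  have := Real.rpow_pos_of_pos hk (d / 2)
  have := Real.rpow_pos_of_pos hpi (d / 2)
  have := Real.rpow_pos_of_pos hpi (2 * s)
  field_simp

/-- The constant in `∫ |2πξ|^{2s} |𝓕 g|² = K ∫₀^∞ p(τ)² τ^{s+N/2-1} dτ`. -/
noncomputable def energyConst (N : ℕ) (s : ℝ) : ℝ :=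
  2 ^ (2 * s) * Real.Gamma (s + 1) ^ 2 * (N * unitBallVol N / 2)

/-- Both sides are quadratic in the coefficients of P, so it suffices to match them for each pair of
exponentials. There Γ(s + N/2)(m + k)^{-(s+N/2)} is ∫₀^∞ τ^{s+N/2-1} e^{-(m+k)τ} dτ. -/
theorem fourierEnergy_gaussPoly (hN : 0 < N) {s : ℝ} (hs : 0 < s) (P : Polynomial ℝ) :
    fourierEnergy (N := N) s (fun x => (gaussPoly s P x : ℂ))
      = ENNReal.ofReal (energyConst N s *
          ∫ τ in Set.Ioi (0 : ℝ), τ ^ (s + N / 2 - 1) * expPoly P τ ^ 2) := by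
  have hν : 0 < s + (N : ℝ) / 2 := by positivity
  set R := Finset.range (P.natDegree + 1) with hR
  set a : ℕ → ℝ := fun i => P.coeff i * (Real.Gamma (s + 1) * (i + 1 : ℝ) ^ (-s))
    * (Real.pi / (i + 1)) ^ (N / 2 : ℝ) with ha
  set b : ℕ → ℕ → ℝ := fun i j => Real.pi ^ 2 / (i + 1) + Real.pi ^ 2 / (j + 1) with hb
  have hbpos : ∀ i j, 0 < b i j := fun i j => by have := Real.pi_pos; positivity
  have h1 : ∀ ξ : Space N, ‖(2 * Real.pi) • ξ‖ ^ (2 * s)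
      * ‖𝓕 (fun x : Space N => (gaussPoly s P x : ℂ)) ξ‖ ^ 2
      = ∑ i ∈ R, ∑ j ∈ R, ((2 * Real.pi) ^ (2 * s) * a i * a j) *
          (‖ξ‖ ^ (2 * s) * Real.exp (-b i j * ‖ξ‖ ^ 2)) := by
    intro ξ
    rw [fourier_gaussPoly, Complex.norm_real, Real.norm_eq_abs, sq_abs, norm_two_pi_smul_rpow, sq,
      Finset.sum_mul_sum, Finset.mul_sum]
    refine Finset.sum_congr rfl fun i _ => ?_
    rw [Finset.mul_sum]
    refine Finset.sum_congr rfl fun j _ => ?_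
    have : Real.exp (-b i j * ‖ξ‖ ^ 2) = Real.exp (-(Real.pi ^ 2 / (i + 1)) * ‖ξ‖ ^ 2)
        * Real.exp (-(Real.pi ^ 2 / (j + 1)) * ‖ξ‖ ^ 2) := by
      rw [← Real.exp_add]; congr 1; simp only [hb]; ring
    rw [this]
    simp only [ha]
    ring
  have hint : ∀ i j, Integrable (fun ξ : Space N => ((2 * Real.pi) ^ (2 * s) * a i * a j) *
          (‖ξ‖ ^ (2 * s) * Real.exp (-b i j * ‖ξ‖ ^ 2))) := fun i j =>
    (integrable_rpow_norm_mul_exp hN hs (hbpos i j)).const_mul _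
  have h2 : ∀ τ : ℝ, τ ^ (s + N / 2 - 1) * expPoly P τ ^ 2
      = ∑ i ∈ R, ∑ j ∈ R, (P.coeff i * P.coeff j) *
        (τ ^ (s + N / 2 - 1) * Real.exp (-(((i + 1 : ℝ) + (j + 1)) * τ))) := by
    intro τ
    rw [expPoly_eq_sum, sq, Finset.sum_mul_sum, Finset.mul_sum]
    refine Finset.sum_congr rfl fun i _ => ?_
    rw [Finset.mul_sum]
    refine Finset.sum_congr rfl fun j _ => ?_
    rw [add_mul ((i : ℝ) + 1), neg_add, Real.exp_add]
    ring
  rw [fourierEnergy, ← ofReal_integral_eq_lintegral_ofReal]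
  · congr 1
    simp_rw [h1, h2]
    rw [integral_finsetSum _ fun i _ => integrable_finsetSum _ fun j _ => hint i j,
      integral_finsetSum _ fun i _ => integrable_finsetSum _ fun j _ =>
        (integrableOn_rpow_mul_exp_neg hν (by positivity)).const_mul _, Finset.mul_sum]
    refine Finset.sum_congr rfl fun i _ => ?_
    rw [integral_finsetSum _ fun j _ => hint i j, integral_finsetSum _ fun j _ =>
        (integrableOn_rpow_mul_exp_neg hν (by positivity)).const_mul _, Finset.mul_sum]
    refine Finset.sum_congr rfl fun j _ => ?_
    rw [integral_const_mul, integral_const_mul, integral_rpow_norm_mul_exp hN hs (hbpos i j),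
      integral_rpow_mul_exp_neg hν (by positivity)]
    have hc := rpow_gaussian_constants (s := s) (d := N) (m := (i : ℝ) + 1) (k := (j : ℝ) + 1)
      (by positivity) (by positivity)
    simp only [ha, hb, energyConst]
    linear_combination (P.coeff i * P.coeff j * Real.Gamma (s + 1) ^ 2 * (N * unitBallVol N / 2)
      * Real.Gamma (s + N / 2)) * hc
  · simp_rw [h1]
    exact integrable_finsetSum _ fun i _ => integrable_finsetSum _ fun j _ => hint i j
  · exact ae_of_all _ fun ξ => by positivity

/-! ### From Gaussians to the bump: approximation of an indicator -/

/-- `y ↦ y⁻¹ 1_{y > y₀}` is on `[0, 1]` a bounded pointwise limit of polynomials. -/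
theorem exists_polynomial_seq (y₀ : ℝ) (h0 : 0 < y₀) :
    ∃ (C : ℝ) (P : ℕ → Polynomial ℝ), (∀ n, ∀ y ∈ Set.Icc (0 : ℝ) 1, |(P n).eval y| ≤ C) ∧
      ∀ y ∈ Set.Icc (0 : ℝ) 1, Tendsto (fun n => (P n).eval y) atTop (𝓝 (if y₀ < y then y⁻¹ else 0)) := by
  -- A ramp of slope n replaces the jump at y₀, and `max y y₀` keeps the reciprocal below y₀⁻¹.
  -- Weierstrass approximation within 1/(n+1) then costs at most 1 in the uniform bound.
  set g : ℕ → ℝ → ℝ := fun n y => (max y y₀)⁻¹ * min 1 (max 0 (n * (y - y₀))) with hg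
  have hpos : ∀ y, 0 < max y y₀ := fun y => lt_max_of_lt_right h0
  have hgc : ∀ n, Continuous (g n) := fun n => by
    refine Continuous.mul (Continuous.inv₀ (by fun_prop) fun y => (hpos y).ne') (by fun_prop)
  choose P hP using fun n : ℕ => exists_polynomial_near_of_continuousOn 0 1 (g n) (hgc n).continuousOn
    (1 / ((n : ℝ) + 1)) (by positivity)
  refine ⟨y₀⁻¹ + 1, P, fun n y hy => ?_, fun y hy => ?_⟩
  · have h1 : |g n y| ≤ y₀⁻¹ := by
      have hm0 : 0 ≤ min 1 (max 0 (n * (y - y₀))) := le_min zero_le_one (le_max_left _ _)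
      rw [hg, abs_of_nonneg (mul_nonneg (inv_nonneg.2 (hpos y).le) hm0)]
      calc (max y y₀)⁻¹ * min 1 (max 0 (n * (y - y₀))) ≤ y₀⁻¹ * 1 :=
            mul_le_mul (inv_anti₀ h0 (le_max_right _ _)) (min_le_left _ _) hm0 (inv_nonneg.2 h0.le)
        _ = y₀⁻¹ := mul_one _
    have h2 : 1 / ((n : ℝ) + 1) ≤ 1 := by
      rw [div_le_one (by positivity)]; linarith [(Nat.cast_nonneg n : (0 : ℝ) ≤ n)]
    have h3 := (hP n y hy).le
    calc |(P n).eval y| = |g n y + ((P n).eval y - g n y)| := by ring_nf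
      _ ≤ |g n y| + |(P n).eval y - g n y| := abs_add_le _ _
      _ ≤ _ := by linarith
  · have h1 : Tendsto (fun n => (P n).eval y - g n y) atTop (𝓝 0) :=
      squeeze_zero_norm (fun n => (hP n y hy).le) tendsto_one_div_add_atTop_nhds_zero_nat
    have h2 : Tendsto (fun n => g n y) atTop (𝓝 (if y₀ < y then y⁻¹ else 0)) := by
      split_ifs with h
      · refine tendsto_const_nhds.congr' ?_
        have : Tendsto (fun n : ℕ => (n : ℝ) * (y - y₀)) atTop atTop :=
          tendsto_natCast_atTop_atTop.atTop_mul_const (sub_pos.2 h)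
        filter_upwards [this.eventually_ge_atTop 1] with n hn
        simp only [hg]
        rw [max_eq_left h.le, max_eq_right (by linarith), min_eq_left hn, mul_one]
      · refine tendsto_const_nhds.congr fun n => ?_
        simp only [hg]
        rw [max_eq_left (b := (n : ℝ) * (y - y₀))
          (mul_nonpos_of_nonneg_of_nonpos (Nat.cast_nonneg n) (by linarith))]
        simp
    simpa using h1.add h2

/-- The indicator function of `[0, r)` is the limit of functions `expPoly P`, dominated by a multiple of `e^{-τ}`. -/
theorem exists_expPoly_seq (r : ℝ) :
    ∃ (C : ℝ) (P : ℕ → Polynomial ℝ), (∀ n, ∀ τ, 0 ≤ τ → |expPoly (P n) τ| ≤ C * Real.exp (-τ)) ∧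
      ∀ τ, 0 ≤ τ → Tendsto (fun n => expPoly (P n) τ) atTop (𝓝 (if τ < r then 1 else 0)) := by
  obtain ⟨C, P, hC, hP⟩ := exists_polynomial_seq (Real.exp (-r)) (Real.exp_pos _)
  have hmem : ∀ τ : ℝ, 0 ≤ τ → Real.exp (-τ) ∈ Set.Icc (0 : ℝ) 1 := fun τ hτ =>
    ⟨(Real.exp_pos _).le, Real.exp_le_one_iff.2 (by linarith)⟩
  refine ⟨C, P, fun n τ hτ => ?_, fun τ hτ => ?_⟩
  · rw [expPoly, abs_mul, abs_of_pos (Real.exp_pos _), mul_comm]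
    exact mul_le_mul_of_nonneg_right (hC n _ (hmem τ hτ)) (Real.exp_pos _).le
  · have := (hP _ (hmem τ hτ)).const_mul (Real.exp (-τ))
    -- With y = e^{-τ}, the condition τ < r reads y > e^{-r}; the factor y⁻¹ in the limit undoes the
    -- factor e^{-τ} in `expPoly`.
    have e : (if τ < r then (1 : ℝ) else 0) = Real.exp (-τ) *
        (if Real.exp (-r) < Real.exp (-τ) then (Real.exp (-τ))⁻¹ else 0) := by
      simp only [Real.exp_lt_exp, neg_lt_neg_iff]
      split_ifs
      · rw [mul_inv_cancel₀ (Real.exp_pos _).ne']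
      · rw [mul_zero]
    rw [e]
    exact this

/-- The function `x ↦ (R² - |x - x₀|²)₊^s`. -/
noncomputable def bump (s R : ℝ) (x₀ x : Space N) : ℝ := (max 0 (R ^ 2 - ‖x - x₀‖ ^ 2)) ^ s

theorem integral_Ioi_rpow_mul_lt {a : ℝ} (ha : 0 < a) (c r : ℝ) :
    ∫ σ in Set.Ioi (0 : ℝ), σ ^ (a - 1) * (if c + σ < r then 1 else 0) = (max 0 (r - c)) ^ a / a := by
  have h1 : ∀ σ : ℝ, σ ^ (a - 1) * (if c + σ < r then 1 else 0)
      = (Set.Iio (r - c)).indicator (fun σ => σ ^ (a - 1)) σ := fun σ => by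
    by_cases h : σ < r - c
    · rw [Set.indicator_of_mem (by exact h), if_pos (by linarith), mul_one]
    · rw [Set.indicator_of_notMem (by exact h), if_neg (by linarith), mul_zero]
  simp_rw [h1]
  rw [setIntegral_indicator measurableSet_Iio, Set.Ioi_inter_Iio]
  rcases le_or_gt (r - c) 0 with h | h
  · rw [Set.Ioo_eq_empty (by linarith), max_eq_left h, Real.zero_rpow ha.ne']
    simp
  · rw [max_eq_right h.le, ← integral_Ioc_eq_integral_Ioo, ← intervalIntegral.integral_of_le h.le,
      integral_rpow (Or.inl (by linarith)), sub_add_cancel, Real.zero_rpow ha.ne', sub_zero]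

theorem abs_gaussPoly_le {s : ℝ} (hs : 0 < s) {P : Polynomial ℝ} {C : ℝ}
    (hP : ∀ τ, 0 ≤ τ → |expPoly P τ| ≤ C * Real.exp (-τ)) (x : Space N) :
    |gaussPoly s P x| ≤ s * (C * Real.Gamma s) * Real.exp (-1 * ‖x‖ ^ 2) := by
  rw [gaussPoly_eq_integral hs, abs_mul, abs_of_pos hs, mul_assoc]
  refine mul_le_mul_of_nonneg_left ?_ hs.le
  have hi := integrableOn_rpow_mul_exp_neg hs one_pos
  calc |∫ σ in Set.Ioi (0 : ℝ), σ ^ (s - 1) * expPoly P (‖x‖ ^ 2 + σ)|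
      ≤ ∫ σ in Set.Ioi (0 : ℝ), (C * Real.exp (-1 * ‖x‖ ^ 2)) * (σ ^ (s - 1) * Real.exp (-(1 * σ))) := by
        rw [← Real.norm_eq_abs]
        refine norm_integral_le_of_norm_le (hi.const_mul _) ?_
        refine (ae_restrict_iff' measurableSet_Ioi).2 (ae_of_all _ fun σ (hσ : 0 < σ) => ?_)
        rw [Real.norm_eq_abs, abs_mul, abs_of_nonneg (Real.rpow_nonneg hσ.le _)]
        refine (mul_le_mul_of_nonneg_left (hP _ (by positivity)) (Real.rpow_nonneg hσ.le _)).trans_eq ?_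
        rw [neg_add, Real.exp_add]
        ring_nf
    _ = C * Real.Gamma s * Real.exp (-1 * ‖x‖ ^ 2) := by
        rw [integral_const_mul, integral_rpow_mul_exp_neg hs one_pos, Real.one_rpow]
        ring

/-- The bump is the same fractional integral, taken of the indicator of [0, R²), so dominated
convergence in σ applies. -/
theorem tendsto_gaussPoly {s R : ℝ} (hs : 0 < s) {P : ℕ → Polynomial ℝ} {C : ℝ}
    (hC : ∀ n, ∀ τ, 0 ≤ τ → |expPoly (P n) τ| ≤ C * Real.exp (-τ))
    (hP : ∀ τ, 0 ≤ τ → Tendsto (fun n => expPoly (P n) τ) atTop (𝓝 (if τ < R ^ 2 then 1 else 0)))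
    (x : Space N) : Tendsto (fun n => gaussPoly s (P n) x) atTop (𝓝 (bump s R 0 x)) := by
  have e : bump s R 0 x = s * ∫ σ in Set.Ioi (0 : ℝ), σ ^ (s - 1) * (if ‖x‖ ^ 2 + σ < R ^ 2 then 1 else 0) := by
    rw [integral_Ioi_rpow_mul_lt hs, bump, sub_zero]
    field_simp
  simp_rw [gaussPoly_eq_integral hs]
  rw [e]
  refine Tendsto.const_mul _ ?_
  refine tendsto_integral_of_dominated_convergence
    (fun σ => (C * Real.exp (-1 * ‖x‖ ^ 2)) * (σ ^ (s - 1) * Real.exp (-(1 * σ)))) (fun n => ?_)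
    ((integrableOn_rpow_mul_exp_neg hs one_pos).const_mul _) (fun n => ?_) ?_
  · refine Measurable.aestronglyMeasurable (Measurable.mul (by fun_prop) ?_)
    exact (continuous_expPoly _).measurable.comp (by fun_prop)
  · refine (ae_restrict_iff' measurableSet_Ioi).2 (ae_of_all _ fun σ (hσ : 0 < σ) => ?_)
    rw [Real.norm_eq_abs, abs_mul, abs_of_nonneg (Real.rpow_nonneg hσ.le _)]
    refine (mul_le_mul_of_nonneg_left (hC n _ (by positivity)) (Real.rpow_nonneg hσ.le _)).trans_eq ?_
    rw [neg_add, Real.exp_add]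
    ring_nf
  · refine (ae_restrict_iff' measurableSet_Ioi).2 (ae_of_all _ fun σ (hσ : 0 < σ) => ?_)
    exact (hP _ (by positivity)).const_mul _

/-- The energies of the Gaussian approximations converge to the right-hand side, and their
transforms converge pointwise. Fatou's lemma gives an inequality, which is all that an upper bound
for an infimum requires. -/
theorem fourierEnergy_bump_zero_le (hN : 0 < N) {s : ℝ} (hs : 0 < s) {R : ℝ} (hR : 0 < R) :
    fourierEnergy (N := N) s (fun x => (bump s R 0 x : ℂ))
      ≤ ENNReal.ofReal (energyConst N s * (R ^ (2 * s + N) / (s + N / 2))) := by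
  have hν : 0 < s + (N : ℝ) / 2 := by positivity
  obtain ⟨C, P, hC, hP⟩ := exists_expPoly_seq (R ^ 2)
  have hC0 : 0 ≤ C := by
    have := (abs_nonneg _).trans (hC 0 0 le_rfl)
    simpa using this
  -- All approximations lie below one fixed Gaussian, so the Fourier integrals converge for every ξ.
  have hF : ∀ ξ : Space N, Tendsto (fun n => 𝓕 (fun x : Space N => (gaussPoly s (P n) x : ℂ)) ξ) atTop
      (𝓝 (𝓕 (fun x : Space N => (bump s R 0 x : ℂ)) ξ)) := by
    intro ξ
    simp_rw [Real.fourier_eq]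
    refine tendsto_integral_of_dominated_convergence
      (fun x => s * (C * Real.Gamma s) * Real.exp (-1 * ‖x‖ ^ 2)) (fun n => ?_)
      ((integrable_exp_norm_sq one_pos).const_mul _) (fun n => ae_of_all _ fun x => ?_)
      (ae_of_all _ fun x => ?_)
    · refine Continuous.aestronglyMeasurable ?_
      refine Continuous.smul (by fun_prop) (Complex.continuous_ofReal.comp (continuous_gaussPoly s _))
    · rw [Circle.norm_smul, Complex.norm_real]
      exact abs_gaussPoly_le hs (hC n) x
    · exact ((Complex.continuous_ofReal.tendsto _).comp (tendsto_gaussPoly hs hC hP x)).const_smul _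
  have hI : Tendsto (fun n => ∫ τ in Set.Ioi (0 : ℝ), τ ^ (s + N / 2 - 1) * expPoly (P n) τ ^ 2) atTop
      (𝓝 (R ^ (2 * s + N) / (s + N / 2))) := by
    have e : R ^ (2 * s + N) / (s + N / 2)
        = ∫ τ in Set.Ioi (0 : ℝ), τ ^ (s + N / 2 - 1) * (if τ < R ^ 2 then 1 else 0) := by
      have := integral_Ioi_rpow_mul_lt hν 0 (R ^ 2)
      simp only [zero_add, sub_zero] at this
      rw [this, max_eq_right (by positivity), ← Real.rpow_natCast, ← Real.rpow_mul hR.le]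
      congr 2
      push_cast
      ring
    rw [e]
    refine tendsto_integral_of_dominated_convergence
      (fun τ => C ^ 2 * (τ ^ (s + N / 2 - 1) * Real.exp (-(2 * τ)))) (fun n => ?_)
      ((integrableOn_rpow_mul_exp_neg hν two_pos).const_mul _) (fun n => ?_) ?_
    · refine Measurable.aestronglyMeasurable (Measurable.mul (by fun_prop) ?_)
      exact (continuous_expPoly _).measurable.pow_const 2
    · refine (ae_restrict_iff' measurableSet_Ioi).2 (ae_of_all _ fun τ (hτ : 0 < τ) => ?_)
      rw [Real.norm_of_nonneg (mul_nonneg (Real.rpow_nonneg hτ.le _) (sq_nonneg _)), mul_left_comm]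
      refine mul_le_mul_of_nonneg_left ?_ (Real.rpow_nonneg hτ.le _)
      rw [← sq_abs]
      refine (pow_le_pow_left₀ (abs_nonneg _) (hC n τ hτ.le) 2).trans_eq ?_
      rw [mul_pow, ← Real.exp_nat_mul]
      congr 2
      push_cast
      ring
    · refine (ae_restrict_iff' measurableSet_Ioi).2 (ae_of_all _ fun τ (hτ : 0 < τ) => ?_)
      have := ((hP τ hτ.le).pow 2).const_mul (τ ^ (s + (N : ℝ) / 2 - 1))
      simpa [ite_pow] using this
  have hE : Tendsto (fun n => fourierEnergy (N := N) s (fun x => (gaussPoly s (P n) x : ℂ))) atTop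
      (𝓝 (ENNReal.ofReal (energyConst N s * (R ^ (2 * s + N) / (s + N / 2))))) := by
    simp_rw [fourierEnergy_gaussPoly hN hs]
    exact ENNReal.tendsto_ofReal (hI.const_mul _)
  rw [← hE.liminf_eq, fourierEnergy]
  calc ∫⁻ ξ : Space N, ENNReal.ofReal (‖(2 * Real.pi) • ξ‖ ^ (2 * s) * ‖𝓕 (fun x => (bump s R 0 x : ℂ)) ξ‖ ^ 2)
      = ∫⁻ ξ : Space N, liminf (fun n => ENNReal.ofReal (‖(2 * Real.pi) • ξ‖ ^ (2 * s)
          * ‖𝓕 (fun x : Space N => (gaussPoly s (P n) x : ℂ)) ξ‖ ^ 2)) atTop := by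
        refine lintegral_congr fun ξ => ?_
        exact (ENNReal.tendsto_ofReal (((hF ξ).norm.pow 2).const_mul _)).liminf_eq.symm
    _ ≤ _ := by
        refine lintegral_liminf_le fun n => ?_
        simp_rw [fourier_gaussPoly]
        fun_prop

theorem fourier_comp_sub_right (f : Space N → ℂ) (x₀ ξ : Space N) :
    ‖𝓕 (fun x => f (x - x₀)) ξ‖ = ‖𝓕 f ξ‖ := by
  have h := VectorFourier.fourierIntegral_comp_add_right Real.fourierChar (volume : Measure (Space N))
    (innerₗ (Space N)) f (-x₀)
  have h2 := congrFun h ξ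
  have e : (f ∘ fun v => v + -x₀) = fun x => f (x - x₀) := by
    ext x; simp [sub_eq_add_neg]
  rw [e] at h2
  change ‖VectorFourier.fourierIntegral Real.fourierChar volume (innerₗ (Space N)) (fun x => f (x - x₀)) ξ‖ = _
  rw [h2, Circle.norm_smul]
  rfl

theorem fourierEnergy_bump_le (hN : 0 < N) {s : ℝ} (hs : 0 < s) {R : ℝ} (hR : 0 < R) (x₀ : Space N) :
    fourierEnergy (N := N) s (fun x => (bump s R x₀ x : ℂ))
      ≤ ENNReal.ofReal (energyConst N s * (R ^ (2 * s + N) / (s + N / 2))) := by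
  refine le_trans (le_of_eq ?_) (fourierEnergy_bump_zero_le hN hs hR)
  unfold fourierEnergy
  refine lintegral_congr fun ξ => ?_
  have := fourier_comp_sub_right (fun x => (bump s R 0 x : ℂ)) x₀ ξ
  simp only [bump, sub_zero] at this ⊢
  rw [this]

/-! ### Norms of the bump as Beta integrals; its membership in H^s -/

theorem integral_Ioi_rpow_mul_one_sub {b a : ℝ} (hb : 0 < b) (ha : 0 < a) :
    ∫ t in Set.Ioi (0 : ℝ), t ^ (b - 1) * (max 0 (1 - t)) ^ a = ProbabilityTheory.beta b (a + 1) := by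
  have h1 : ∫ t in Set.Ioi (0 : ℝ), t ^ (b - 1) * (max 0 (1 - t)) ^ a
      = ∫ t in Set.Ioc (0 : ℝ) 1, t ^ (b - 1) * (1 - t) ^ a := by
    have : ∀ t : ℝ, t ^ (b - 1) * (max 0 (1 - t)) ^ a
        = (Set.Iic (1 : ℝ)).indicator (fun t => t ^ (b - 1) * (1 - t) ^ a) t := fun t => by
      by_cases h : t ≤ 1
      · rw [Set.indicator_of_mem (by exact h), max_eq_right (by linarith)]
      · rw [Set.indicator_of_notMem (by exact h), max_eq_left (by linarith), Real.zero_rpow ha.ne', mul_zero]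
    simp_rw [this]
    rw [setIntegral_indicator measurableSet_Iic, Set.Ioi_inter_Iic]
  rw [h1, ProbabilityTheory.beta_eq_betaIntegralReal _ _ hb (by linarith), Complex.betaIntegral,
    ← intervalIntegral.integral_of_le zero_le_one]
  have h2 : ∫ x : ℝ in 0..1, (x : ℂ) ^ ((b : ℂ) - 1) * (1 - (x : ℂ)) ^ (((a + 1 : ℝ) : ℂ) - 1)
      = ∫ x : ℝ in 0..1, ((x ^ (b - 1) * (1 - x) ^ a : ℝ) : ℂ) := by
    refine intervalIntegral.integral_congr fun x hx => ?_
    rw [Set.uIcc_of_le zero_le_one] at hx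
    rw [Complex.ofReal_mul, Complex.ofReal_cpow hx.1, Complex.ofReal_cpow (by linarith [hx.2])]
    push_cast
    ring_nf
  rw [h2, intervalIntegral.integral_ofReal, Complex.ofReal_re]

/-- Substitute t = y² and rescale t = R² x. In polar coordinates this is the radial integral with b
= N/2. -/
theorem integral_Ioi_rpow_mul_sq_sub {b a R : ℝ} (hb : 0 < b) (ha : 0 < a) (hR : 0 < R) :
    ∫ y in Set.Ioi (0 : ℝ), y ^ (2 * b - 1) * (max 0 (R ^ 2 - y ^ 2)) ^ a
      = R ^ (2 * b + 2 * a) / 2 * ProbabilityTheory.beta b (a + 1) := by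
  have h1 := integral_comp_rpow_Ioi_of_pos (g := fun t : ℝ => t ^ (b - 1) * (max 0 (R ^ 2 - t)) ^ a)
    (p := 2) two_pos
  have h2 := integral_comp_mul_left_Ioi' (fun t : ℝ => t ^ (b - 1) * (max 0 (R ^ 2 - t)) ^ a) 0
    (b := R ^ 2) (by positivity)
  rw [mul_zero] at h2
  have e1 : ∫ x in Set.Ioi (0 : ℝ), (2 * x ^ ((2 : ℝ) - 1)) • ((x ^ (2 : ℝ)) ^ (b - 1)
      * (max 0 (R ^ 2 - x ^ (2 : ℝ))) ^ a)
      = 2 * ∫ y in Set.Ioi (0 : ℝ), y ^ (2 * b - 1) * (max 0 (R ^ 2 - y ^ 2)) ^ a := by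
    rw [← integral_const_mul]
    refine setIntegral_congr_fun measurableSet_Ioi fun x (hx : 0 < x) => ?_
    simp only [smul_eq_mul]
    rw [← Real.rpow_mul hx.le, show 2 * b - 1 = ((2 : ℝ) - 1) + 2 * (b - 1) by ring, Real.rpow_add hx,
      Real.rpow_two]
    ring
  have e2 : ∫ x in Set.Ioi (0 : ℝ), (R ^ 2 * x) ^ (b - 1) * (max 0 (R ^ 2 - R ^ 2 * x)) ^ a
      = ((R ^ 2) ^ (b - 1) * (R ^ 2) ^ a) * ProbabilityTheory.beta b (a + 1) := by
    rw [← integral_Ioi_rpow_mul_one_sub hb ha, ← integral_const_mul]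
    refine setIntegral_congr_fun measurableSet_Ioi fun x (hx : 0 < x) => ?_
    rw [Real.mul_rpow (by positivity) hx.le, show R ^ 2 - R ^ 2 * x = R ^ 2 * (1 - x) by ring,
      ← mul_zero (R ^ 2), ← mul_max_of_nonneg _ _ (by positivity : 0 ≤ R ^ 2),
      Real.mul_rpow (by positivity) (le_max_left _ _)]
    simp only [mul_zero]
    ring
  rw [e1] at h1
  rw [e2, ← h1, smul_eq_mul] at h2
  have e3 : R ^ (2 * b + 2 * a) = R ^ 2 * ((R ^ 2) ^ (b - 1) * (R ^ 2) ^ a) := by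
    rw [← Real.rpow_natCast R 2, ← Real.rpow_mul hR.le, ← Real.rpow_mul hR.le, ← Real.rpow_add hR,
      ← Real.rpow_add hR]
    push_cast
    ring_nf
  rw [e3]
  linarith

theorem integral_max_sq_sub (hN : 0 < N) {a R : ℝ} (ha : 0 < a) (hR : 0 < R) (x₀ : Space N) :
    ∫ x : Space N, (max 0 (R ^ 2 - ‖x - x₀‖ ^ 2)) ^ a
      = N * unitBallVol N / 2 * ProbabilityTheory.beta (N / 2) (a + 1) * R ^ (N + 2 * a) := by
  have : Nontrivial (Space N) := by
    have : Nonempty (Fin N) := ⟨⟨0, hN⟩⟩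
    infer_instance
  have hN' : (0 : ℝ) < N := by exact_mod_cast hN
  rw [integral_sub_right_eq_self (fun x : Space N => (max 0 (R ^ 2 - ‖x‖ ^ 2)) ^ a) x₀,
    integral_fun_norm_addHaar (volume : Measure (Space N)) (fun r : ℝ => (max 0 (R ^ 2 - r ^ 2)) ^ a)]
  have h2 : ∫ y in Set.Ioi (0 : ℝ), y ^ (Module.finrank ℝ (Space N) - 1)
        • (max 0 (R ^ 2 - y ^ 2)) ^ a
      = ∫ y in Set.Ioi (0 : ℝ), y ^ (2 * ((N : ℝ) / 2) - 1) * (max 0 (R ^ 2 - y ^ 2)) ^ a := by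
    refine setIntegral_congr_fun measurableSet_Ioi fun y hy => ?_
    simp only [finrank_euclideanSpace, Fintype.card_fin, smul_eq_mul]
    rw [← Real.rpow_natCast y (N - 1), Nat.cast_sub hN]
    push_cast
    ring_nf
  rw [h2, integral_Ioi_rpow_mul_sq_sub (by positivity) ha hR]
  simp only [finrank_euclideanSpace, Fintype.card_fin, smul_eq_mul, nsmul_eq_mul, unitBallVol]
  ring_nf

theorem bump_nonneg (s R : ℝ) (x₀ x : Space N) : 0 ≤ bump s R x₀ x :=
  Real.rpow_nonneg (le_max_left _ _) _

theorem continuous_bump {s : ℝ} (hs : 0 < s) (R : ℝ) (x₀ : Space N) : Continuous (bump s R x₀) := by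
  unfold bump
  exact Continuous.rpow_const (by fun_prop) fun _ => Or.inr hs.le

theorem bump_eq_zero {s R : ℝ} (hs : 0 < s) (hR : 0 ≤ R) {x₀ x : Space N} (h : x ∉ Metric.ball x₀ R) :
    bump s R x₀ x = 0 := by
  rw [Metric.mem_ball, dist_eq_norm, not_lt] at h
  rw [bump, max_eq_left (by nlinarith), Real.zero_rpow hs.ne']

theorem hasCompactSupport_bump {s R : ℝ} (hs : 0 < s) (hR : 0 ≤ R) (x₀ : Space N) :
    HasCompactSupport (bump s R x₀) :=
  HasCompactSupport.intro (isCompact_closedBall x₀ R) fun _ hx =>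
    bump_eq_zero hs hR fun h => hx (Metric.ball_subset_closedBall h)

theorem memLp_bump {s R : ℝ} (hs : 0 < s) (hR : 0 ≤ R) (x₀ : Space N) (p : ℝ≥0∞) :
    MemLp (bump s R x₀) p volume :=
  (continuous_bump hs R x₀).memLp_of_hasCompactSupport (hasCompactSupport_bump hs hR x₀)

theorem not_bump_ae_eq_zero {s R : ℝ} (hs : 0 < s) (hR : 0 < R) (x₀ : Space N) :
    ¬ bump s R x₀ =ᵐ[volume] 0 := by
  intro h
  have h' := (Continuous.ae_eq_iff_eq volume (continuous_bump hs R x₀) continuous_zero).1 h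
  have h2 := congrFun h' x₀
  have h3 : (0 : ℝ) < (R ^ 2 - 0 ^ 2) ^ s := Real.rpow_pos_of_pos (by rw [zero_pow two_ne_zero, sub_zero]; positivity) _
  rw [bump, sub_self, norm_zero, max_eq_right (by rw [zero_pow two_ne_zero, sub_zero]; positivity)] at h2
  exact h3.ne' h2

theorem lpNorm_bump (hN : 0 < N) {s q R : ℝ} (hs : 0 < s) (hq : 0 < q) (hR : 0 < R) (x₀ : Space N) :
    lpNorm (bump s R x₀) (ENNReal.ofReal q) volume
      = (N * unitBallVol N / 2 * ProbabilityTheory.beta (N / 2) (q * s + 1) * R ^ (N + 2 * (q * s))) ^ (1 / q) := by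
  rw [lpNorm_eq_integral_norm_rpow_toReal (by simpa using hq) (by simp)
    (continuous_bump hs R x₀).aestronglyMeasurable, ENNReal.toReal_ofReal hq.le,
    ← integral_max_sq_sub hN (mul_pos hq hs) hR x₀, one_div]
  congr 2
  ext x
  rw [Real.norm_of_nonneg (bump_nonneg _ _ _ _), bump, ← Real.rpow_mul (le_max_left _ _), mul_comm]

theorem lpNorm_restrict_bump {s q R : ℝ} (hs : 0 < s) (hR : 0 ≤ R) {x₀ : Space N} {Ω : Set (Space N)}
    (hΩ : IsOpen Ω) (h : Metric.ball x₀ R ⊆ Ω) :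
    lpNorm (bump s R x₀) (ENNReal.ofReal q) (volume.restrict Ω)
      = lpNorm (bump s R x₀) (ENNReal.ofReal q) volume := by
  have hm := (continuous_bump hs R x₀).aestronglyMeasurable (μ := volume)
  rw [← toReal_eLpNorm hm, ← toReal_eLpNorm hm.restrict,
    ← eLpNorm_indicator_eq_eLpNorm_restrict hΩ.measurableSet]
  congr 2
  refine Set.indicator_eq_self.2 fun x hx => ?_
  by_contra hxΩ
  exact hx (bump_eq_zero hs hR fun hb => hxΩ (h hb))

theorem eLpNorm_symbol_sq {s : ℝ} {u : Space N → ℝ} (h1 : Integrable u) (h2 : MemLp u 2 volume) :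
    eLpNorm (fracLapSymbol (s / 2) u) 2 volume ^ 2 = fourierEnergy s (fun x => (u x : ℂ)) := by
  rw [eLpNorm_eq_lintegral_rpow_enorm_toReal two_ne_zero ENNReal.ofNat_ne_top, ← ENNReal.rpow_natCast,
    ← ENNReal.rpow_mul]
  norm_num
  refine lintegral_congr_ae ?_
  filter_upwards [l2Fourier_ae_eq h1 h2] with ξ hξ
  rw [fracLapSymbol, hξ, ← ofReal_norm, ← ENNReal.ofReal_pow (norm_nonneg _), norm_mul, mul_pow,
    Complex.norm_real, Real.norm_of_nonneg (by positivity), ← Real.rpow_natCast, ← Real.rpow_mul (norm_nonneg _)]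
  congr 3
  push_cast
  ring_nf

/-- The energy bound is finite, so it also proves that the bump belongs to H^s. -/
theorem bump_energy (hN : 0 < N) {s R : ℝ} (hs : 0 < s) (hR : 0 < R) (x₀ : Space N) :
    MemHs s (bump s R x₀) ∧
      ‖fracLap (s / 2) (bump s R x₀)‖ ^ 2 ≤ energyConst N s * (R ^ (2 * s + N) / (s + N / 2)) := by
  have hm := memLp_bump hs hR.le x₀
  have hi := memLp_one_iff_integrable.1 (hm 1)
  have h1 := eLpNorm_symbol_sq (s := s) hi (hm 2)
  have h2 := fourierEnergy_bump_le hN hs hR x₀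
  rw [← h1] at h2
  have hmem : MemLp (fracLapSymbol (s / 2) (bump s R x₀)) 2 volume := by
    refine ⟨AEStronglyMeasurable.mul (Measurable.aestronglyMeasurable (by fun_prop))
      (Lp.aestronglyMeasurable _), ?_⟩
    by_contra h
    rw [not_lt, top_le_iff] at h
    rw [h] at h2
    simp at h2
  refine ⟨MemHs.of_memLp_symbol (hm 2) hmem, ?_⟩
  rw [norm_fracLap hmem, ← ENNReal.toReal_pow]
  have hK : 0 ≤ energyConst N s := by
    have := unitBallVol_pos (N := N)
    unfold energyConst; positivity
  exact ENNReal.toReal_le_of_le_ofReal (by positivity) h2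

/-! ### Energy of Schwartz functions, real parts and cutoffs -/

/-- The norm `‖ |2πξ|^{2σ} 𝓕F ‖_{L²}` of a Schwartz function. -/
noncomputable def schwartzEnergy (σ : ℝ) (F : 𝓢(Space N, ℂ)) : ℝ≥0∞ :=
  eLpNorm (fun ξ => ((‖(2 * Real.pi) • ξ‖ ^ (2 * σ) : ℝ) : ℂ) * 𝓕 F ξ) 2 volume

theorem aestronglyMeasurable_weight_mul (σ : ℝ) {g : Space N → ℂ} (hg : AEStronglyMeasurable g volume) :
    AEStronglyMeasurable (fun ξ : Space N => ((‖(2 * Real.pi) • ξ‖ ^ (2 * σ) : ℝ) : ℂ) * g ξ) volume :=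
  AEStronglyMeasurable.mul (Measurable.aestronglyMeasurable (by fun_prop)) hg

theorem l2Fourier_schwartz {φ : Space N → ℝ} {F : 𝓢(Space N, ℂ)} (h : ∀ x, F x = φ x) :
    l2Fourier φ =ᵐ[volume] (𝓕 F : 𝓢(Space N, ℂ)) := by
  have e : (fun x => (φ x : ℂ)) = F := funext fun x => (h x).symm
  have hm : MemLp (fun x => (φ x : ℂ)) 2 volume := by rw [e]; exact F.memLp 2 volume
  have e2 : hm.toLp (fun x => (φ x : ℂ)) = F.toLp 2 volume := by
    refine Lp.ext ?_
    filter_upwards [hm.coeFn_toLp, F.coeFn_toLp 2 volume] with x h1 h2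
    rw [h1, h2, h]
  rw [l2Fourier, dif_pos hm, e2, SchwartzMap.toLp_fourier_eq]
  exact (𝓕 F).coeFn_toLp 2 volume

theorem eLpNorm_symbol_schwartz (σ : ℝ) {φ : Space N → ℝ} {F : 𝓢(Space N, ℂ)} (h : ∀ x, F x = φ x) :
    eLpNorm (fracLapSymbol σ φ) 2 volume = schwartzEnergy σ F := by
  refine eLpNorm_congr_ae ?_
  filter_upwards [l2Fourier_schwartz h] with ξ hξ
  rw [fracLapSymbol, hξ]

theorem schwartzEnergy_add_le (σ : ℝ) (F G : 𝓢(Space N, ℂ)) :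
    schwartzEnergy σ (F + G) ≤ schwartzEnergy σ F + schwartzEnergy σ G := by
  have e : (fun ξ => ((‖(2 * Real.pi) • ξ‖ ^ (2 * σ) : ℝ) : ℂ) * 𝓕 (F + G) ξ)
      = (fun ξ => ((‖(2 * Real.pi) • ξ‖ ^ (2 * σ) : ℝ) : ℂ) * 𝓕 F ξ)
        + fun ξ => ((‖(2 * Real.pi) • ξ‖ ^ (2 * σ) : ℝ) : ℂ) * 𝓕 G ξ := by
    ext ξ
    rw [FourierTransform.fourier_add]
    simp [mul_add]
  rw [schwartzEnergy, e]
  exact eLpNorm_add_le (aestronglyMeasurable_weight_mul σ (𝓕 F).continuous.aestronglyMeasurable)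
    (aestronglyMeasurable_weight_mul σ (𝓕 G).continuous.aestronglyMeasurable) one_le_two

theorem norm_fourier_eLpNorm (F : 𝓢(Space N, ℂ)) :
    eLpNorm (𝓕 F : 𝓢(Space N, ℂ)) 2 volume = eLpNorm F 2 volume := by
  have h := SchwartzMap.norm_fourier_toL2_eq F
  rw [SchwartzMap.norm_toLp, SchwartzMap.norm_toLp] at h
  exact (ENNReal.toReal_eq_toReal_iff' ((𝓕 F).memLp 2 volume).eLpNorm_ne_top
    (F.memLp 2 volume).eLpNorm_ne_top).1 h

/-- As 2σ ≤ 1, the weight |2πξ|^{2σ} is at most 1 + ∑ |2πξ_i|, and Plancherel turns each term into a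
norm of F or of a first derivative. Cutoff errors can thus be estimated without nonlocal terms. -/
theorem schwartzEnergy_le {σ : ℝ} (h0 : 0 ≤ σ) (h1 : 2 * σ ≤ 1) (F : 𝓢(Space N, ℂ)) :
    schwartzEnergy σ F ≤ eLpNorm F 2 volume
      + ∑ i : Fin N, eLpNorm (∂_{EuclideanSpace.single i (1 : ℝ)} F : 𝓢(Space N, ℂ)) 2 volume := by
  have hd : ∀ i : Fin N, ∀ ξ : Space N, ‖𝓕 (∂_{EuclideanSpace.single i (1 : ℝ)} F) ξ‖
      = 2 * Real.pi * |ξ i| * ‖𝓕 F ξ‖ := by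
    intro i ξ
    have hg : (fun x : Space N => inner ℝ x (EuclideanSpace.single i (1 : ℝ))).HasTemperateGrowth := by
      fun_prop
    rw [SchwartzMap.fourier_lineDerivOp_eq]
    simp only [smul_apply, SchwartzMap.smulLeftCLM_apply_apply hg, norm_smul]
    simp [EuclideanSpace.inner_single_right, abs_of_pos Real.pi_pos]
    ring
  calc schwartzEnergy σ F ≤ eLpNorm (fun ξ => ‖𝓕 F ξ‖
        + ∑ i : Fin N, ‖𝓕 (∂_{EuclideanSpace.single i (1 : ℝ)} F) ξ‖) 2 volume := by
        refine eLpNorm_mono_real fun ξ => ?_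
        simp_rw [hd]
        rw [norm_mul, Complex.norm_real, Real.norm_of_nonneg (by positivity), ← Finset.sum_mul,
          ← Finset.mul_sum, ← one_add_mul]
        refine mul_le_mul_of_nonneg_right ?_ (norm_nonneg _)
        have h2 : ‖ξ‖ ≤ ∑ i : Fin N, |ξ i| := by
          rw [EuclideanSpace.norm_eq]
          refine Real.sqrt_le_iff.2 ⟨by positivity, ?_⟩
          simp_rw [Real.norm_eq_abs]
          exact Finset.sum_sq_le_sq_sum_of_nonneg fun i _ => abs_nonneg _
        have h3 : ‖(2 * Real.pi) • ξ‖ ≤ 2 * Real.pi * ∑ i : Fin N, |ξ i| := by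
          rw [norm_smul, Real.norm_of_nonneg (by positivity)]
          exact mul_le_mul_of_nonneg_left h2 (by positivity)
        rcases le_or_gt ‖(2 * Real.pi) • ξ‖ 1 with h | h
        · have := Real.rpow_le_one (norm_nonneg _) h (by linarith : 0 ≤ 2 * σ)
          have : 0 ≤ 2 * Real.pi * ∑ i : Fin N, |ξ i| := by positivity
          linarith
        · have := Real.rpow_le_rpow_of_exponent_le h.le h1
          rw [Real.rpow_one] at this
          linarith
    _ ≤ eLpNorm (fun ξ => ‖𝓕 F ξ‖) 2 volume
        + ∑ i : Fin N, eLpNorm (fun ξ => ‖𝓕 (∂_{EuclideanSpace.single i (1 : ℝ)} F) ξ‖) 2 volume := by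
        have e : (fun ξ => ‖𝓕 F ξ‖ + ∑ i : Fin N, ‖𝓕 (∂_{EuclideanSpace.single i (1 : ℝ)} F) ξ‖)
            = (fun ξ => ‖𝓕 F ξ‖) + ∑ i : Fin N, fun ξ => ‖𝓕 (∂_{EuclideanSpace.single i (1 : ℝ)} F) ξ‖ := by
          ext ξ; simp
        rw [e]
        have hm : ∀ G : 𝓢(Space N, ℂ), AEStronglyMeasurable (fun ξ => ‖𝓕 G ξ‖) volume := fun G =>
          (𝓕 G).continuous.norm.aestronglyMeasurable
        refine (eLpNorm_add_le (hm _) (Finset.aestronglyMeasurable_sum _ fun i _ => hm _) one_le_two).trans ?_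
        gcongr
        exact eLpNorm_sum_le (fun i _ => hm _) one_le_two
    _ = _ := by
        simp_rw [eLpNorm_norm, norm_fourier_eLpNorm]

/-- The real part of a Schwartz function, as a complex Schwartz function. -/
noncomputable def rePart (F : 𝓢(Space N, ℂ)) : 𝓢(Space N, ℂ) :=
  F.postcompCLM (Complex.ofRealCLM ∘L Complex.reCLM)

theorem rePart_apply (F : 𝓢(Space N, ℂ)) (x : Space N) : rePart F x = ((F x).re : ℂ) := by
  simp [rePart]

theorem fourier_rePart (F : 𝓢(Space N, ℂ)) (ξ : Space N) :
    𝓕 (rePart F) ξ = (1 / 2 : ℂ) * (𝓕 F ξ + (starRingEnd ℂ) (𝓕 F (-ξ))) := by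
  have hF : Integrable F := F.integrable
  rw [SchwartzMap.fourier_coe, SchwartzMap.fourier_coe, Real.fourier_eq, Real.fourier_eq, Real.fourier_eq,
    ← integral_conj, ← integral_add, ← integral_const_mul]
  · refine integral_congr_ae (ae_of_all _ fun x => ?_)
    simp only [rePart_apply, Circle.smul_def, smul_eq_mul, map_mul, inner_neg_right, neg_neg]
    have : (starRingEnd ℂ) (Real.fourierChar (inner ℝ x ξ) : ℂ) = (Real.fourierChar (-inner ℝ x ξ) : ℂ) := by
      rw [← Circle.coe_inv_eq_conj, AddChar.map_neg_eq_inv]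
    rw [this, ← mul_add, Complex.add_conj]
    push_cast
    ring
  · exact (Real.fourierIntegral_convergent_iff ξ).2 hF
  · have h := (Real.fourierIntegral_convergent_iff (μ := volume) (-ξ)).2 hF
    exact (Complex.conjLIE.integrable_comp_iff (μ := volume)).2 h

/-- The transform of Re F averages 𝓕F(ξ) and the conjugate of 𝓕F(-ξ). The weight is even, so both
have the same weighted norm. This is needed because competitors are real-valued. -/
theorem schwartzEnergy_rePart_le (σ : ℝ) (F : 𝓢(Space N, ℂ)) :
    schwartzEnergy σ (rePart F) ≤ schwartzEnergy σ F := by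
  set g : Space N → ℂ := fun ξ => ((‖(2 * Real.pi) • ξ‖ ^ (2 * σ) : ℝ) : ℂ) * 𝓕 F ξ with hg
  have hgm : AEStronglyMeasurable g volume :=
    aestronglyMeasurable_weight_mul σ (𝓕 F).continuous.aestronglyMeasurable
  have hmp := Measure.measurePreserving_neg (volume : Measure (Space N))
  have e : (fun ξ => ((‖(2 * Real.pi) • ξ‖ ^ (2 * σ) : ℝ) : ℂ) * 𝓕 (rePart F) ξ)
      = (1 / 2 : ℂ) • (g + fun ξ => (starRingEnd ℂ) (g (-ξ))) := by
    ext ξ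
    simp only [hg, fourier_rePart, Pi.smul_apply, Pi.add_apply, smul_eq_mul, map_mul, Complex.conj_ofReal,
      smul_neg, norm_neg]
    ring
  have h2 : eLpNorm (fun ξ => (starRingEnd ℂ) (g (-ξ))) 2 volume = eLpNorm g 2 volume := by
    rw [← eLpNorm_comp_measurePreserving hgm hmp]
    refine eLpNorm_congr_norm_ae (ae_of_all _ fun ξ => ?_)
    simp
  have hgm' : AEStronglyMeasurable (fun ξ => (starRingEnd ℂ) (g (-ξ))) volume :=
    Complex.continuous_conj.comp_aestronglyMeasurable (hgm.comp_measurePreserving hmp)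
  rw [schwartzEnergy, e, eLpNorm_const_smul]
  calc ‖(1 / 2 : ℂ)‖ₑ * eLpNorm (g + fun ξ => (starRingEnd ℂ) (g (-ξ))) 2 volume
      ≤ ‖(1 / 2 : ℂ)‖ₑ * (eLpNorm g 2 volume + eLpNorm g 2 volume) := by
        gcongr
        exact (eLpNorm_add_le hgm hgm' one_le_two).trans_eq (by rw [h2])
    _ = schwartzEnergy σ F := by
        rw [← two_mul, ← mul_assoc, schwartzEnergy]
        have : ‖(1 / 2 : ℂ)‖ₑ * 2 = 1 := by
          rw [← ofReal_norm]
          norm_num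
          rw [← ENNReal.ofReal_ofNat 2, ← ENNReal.ofReal_mul (by norm_num)]
          norm_num
        rw [this, one_mul]

theorem memLp_norm_mul_schwartz (F : 𝓢(Space N, ℂ)) :
    MemLp (fun x => ‖x‖ * ‖F x‖) 2 volume := by
  have hg : (fun x : Space N => ((1 + ‖x‖ ^ 2 : ℝ) : ℂ)).HasTemperateGrowth := by
    have := Function.hasTemperateGrowth_one_add_norm_sq_rpow (H := Space N) 1
    simp only [Real.rpow_one] at this
    fun_prop
  refine (((SchwartzMap.smulLeftCLM ℂ fun x : Space N => ((1 + ‖x‖ ^ 2 : ℝ) : ℂ)) F).memLp 2 volume).mono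
    (Continuous.aestronglyMeasurable (by fun_prop)) (ae_of_all _ fun x => ?_)
  rw [SchwartzMap.smulLeftCLM_apply_apply hg, norm_smul, Complex.norm_real,
    Real.norm_of_nonneg (by positivity), Real.norm_of_nonneg (by positivity)]
  refine mul_le_mul_of_nonneg_right ?_ (norm_nonneg _)
  nlinarith [sq_nonneg (‖x‖ - 1), norm_nonneg x]

/-- Cutting off at scale `1 / c` changes a Schwartz function and its first derivatives by `O(c)` in `L²`. -/
theorem exists_cutoff (F : 𝓢(Space N, ℂ)) (φ : Space N → ℝ) (hF : ∀ x, F x = φ x) :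
    ∃ A : ℝ≥0∞, A ≠ ⊤ ∧ ∀ c : ℝ, 0 < c → ∃ (χ : Space N → ℝ) (G : 𝓢(Space N, ℂ)),
      ContDiff ℝ ∞ χ ∧ HasCompactSupport χ ∧ (∀ x, G x = χ x) ∧
      eLpNorm (G - F : 𝓢(Space N, ℂ)) 2 volume ≤ ENNReal.ofReal c * A ∧
      ∀ i : Fin N, eLpNorm (∂_{EuclideanSpace.single i (1 : ℝ)} (G - F) : 𝓢(Space N, ℂ)) 2 volume
        ≤ ENNReal.ofReal c * A := by
  let η : ContDiffBump (0 : Space N) := ⟨1, 2, one_pos, one_lt_two⟩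
  have hηd : ContDiff ℝ ∞ η := η.contDiff
  obtain ⟨L, hL⟩ : ∃ L, ∀ x, ‖fderiv ℝ η x‖ ≤ L :=
    (hηd.continuous_fderiv (by simp)).bounded_above_of_compact_support (η.hasCompactSupport.fderiv ℝ)
  have hL0 : 0 ≤ L := (norm_nonneg _).trans (hL 0)
  have hφd : ContDiff ℝ ∞ φ := by
    have : φ = fun x => Complex.reCLM (F x) := by ext x; simp [hF]
    rw [this]
    exact Complex.reCLM.contDiff.comp (F.smooth ⊤)
  set d : Fin N → 𝓢(Space N, ℂ) := fun i => ∂_{EuclideanSpace.single i (1 : ℝ)} F with hd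
  set A : ℝ≥0∞ := eLpNorm (fun x => ‖x‖ * ‖F x‖) 2 volume
    + ∑ i, eLpNorm (fun x => ‖x‖ * ‖d i x‖ + L * ‖F x‖) 2 volume with hA
  have hAi : ∀ i, MemLp (fun x => ‖x‖ * ‖d i x‖ + L * ‖F x‖) 2 volume := fun i =>
    (memLp_norm_mul_schwartz (d i)).add ((F.memLp 2 volume).norm.const_mul L)
  refine ⟨A, ?_, fun c hc => ?_⟩
  · exact ENNReal.add_ne_top.2 ⟨(memLp_norm_mul_schwartz F).eLpNorm_ne_top,
      ENNReal.sum_ne_top.2 fun i _ => (hAi i).eLpNorm_ne_top⟩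
  set χ : Space N → ℝ := fun x => η (c • x) * φ x with hχ
  have hχd : ContDiff ℝ ∞ χ := (hηd.comp (contDiff_const_smul c)).mul hφd
  have hχc : HasCompactSupport χ :=
    (η.hasCompactSupport.comp_smul hc.ne').mul_right
  have hχc' : HasCompactSupport (fun x => (χ x : ℂ)) := hχc.comp_left (g := Complex.ofReal) (by simp)
  have hχd' : ContDiff ℝ ∞ (fun x => (χ x : ℂ)) := Complex.ofRealCLM.contDiff.comp hχd
  set G : 𝓢(Space N, ℂ) := hχc'.toSchwartzMap hχd' with hG
  have hGx : ∀ x, G x = χ x := fun x => rfl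
  -- The left side vanishes where c|x| ≤ 1 and never exceeds 1. This bound trades the cutoff error
  -- for one factor |x|, which Schwartz decay absorbs.
  have hη1 : ∀ x : Space N, |η (c • x) - 1| ≤ c * ‖x‖ := by
    intro x
    rcases le_or_gt (c * ‖x‖) 1 with h | h
    · rw [η.one_of_mem_closedBall (by simpa [norm_smul, abs_of_pos hc] using h), sub_self, abs_zero]
      positivity
    · rw [abs_sub_comm, abs_of_nonneg (sub_nonneg.2 η.le_one)]
      linarith [η.nonneg (x := c • x)]
  have hdiff : ∀ x, (G - F : 𝓢(Space N, ℂ)) x = ((η (c • x) - 1 : ℝ) : ℂ) * F x := by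
    intro x
    rw [sub_apply, hGx, hχ, hF]
    push_cast
    ring
  refine ⟨χ, G, hχd, hχc, hGx, ?_, fun i => ?_⟩
  · have h1 : eLpNorm (G - F : 𝓢(Space N, ℂ)) 2 volume
        ≤ ENNReal.ofReal c * eLpNorm (fun x => ‖x‖ * ‖F x‖) 2 volume := by
      refine eLpNorm_le_mul_eLpNorm_of_ae_le_mul (ae_of_all _ fun x => ?_) 2
      rw [hdiff, norm_mul, Complex.norm_real, Real.norm_eq_abs, Real.norm_of_nonneg (by positivity), ← mul_assoc]
      exact mul_le_mul_of_nonneg_right (hη1 x) (norm_nonneg _)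
    refine h1.trans ?_
    gcongr
    exact le_self_add
  · have h1 : eLpNorm (∂_{EuclideanSpace.single i (1 : ℝ)} (G - F) : 𝓢(Space N, ℂ)) 2 volume
        ≤ ENNReal.ofReal c * eLpNorm (fun x => ‖x‖ * ‖d i x‖ + L * ‖F x‖) 2 volume := by
      refine eLpNorm_le_mul_eLpNorm_of_ae_le_mul (ae_of_all _ fun x => ?_) 2
      have hη' : HasFDerivAt (fun y : Space N => (((η (c • y) - 1 : ℝ)) : ℂ))
          (Complex.ofRealCLM ∘L (fderiv ℝ η (c • x) ∘L (c • ContinuousLinearMap.id ℝ (Space N)))) x := by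
        refine Complex.ofRealCLM.hasFDerivAt.comp x ?_
        refine HasFDerivAt.sub_const _ ?_
        exact ((hηd.differentiable (by simp)) (c • x)).hasFDerivAt.comp x ((hasFDerivAt_id x).const_smul c)
      -- The product rule gives (η(cx) - 1) ∂F + c (∂η)(cx) F; the second term is at most c L |F|.
      have hD := hη'.mul (F.hasFDerivAt x)
      have hD' : HasFDerivAt (G - F : 𝓢(Space N, ℂ)) _ x := hD.congr_of_eventuallyEq (Eventually.of_forall hdiff)
      rw [SchwartzMap.lineDerivOp_apply_eq_fderiv, hD'.fderiv, Real.norm_of_nonneg (by positivity)]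
      have e : d i x = fderiv ℝ F x (EuclideanSpace.single i (1 : ℝ)) :=
        SchwartzMap.lineDerivOp_apply_eq_fderiv _ _ _
      simp only [add_apply, smul_apply, ContinuousLinearMap.comp_apply, smul_eq_mul, ← e]
      refine (norm_add_le _ _).trans ?_
      rw [mul_add, norm_mul, norm_mul, Complex.norm_real, Real.norm_eq_abs]
      refine add_le_add ?_ ?_
      · rw [← mul_assoc]
        exact mul_le_mul_of_nonneg_right (hη1 x) (norm_nonneg _)
      · have h3 : ‖(Complex.ofRealCLM (fderiv ℝ η (c • x) (c • EuclideanSpace.single i (1 : ℝ))))‖ ≤ c * L := by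
          rw [Complex.ofRealCLM_apply, Complex.norm_real, map_smul, norm_smul, Real.norm_of_nonneg hc.le]
          refine mul_le_mul_of_nonneg_left ?_ hc.le
          refine (ContinuousLinearMap.le_opNorm _ _).trans ?_
          simpa using hL (c • x)
        rw [mul_comm ‖F x‖, ← mul_assoc]
        exact mul_le_mul_of_nonneg_right h3 (norm_nonneg _)
    refine h1.trans ?_
    gcongr
    exact (Finset.single_le_sum (f := fun i => eLpNorm (fun x => ‖x‖ * ‖d i x‖ + L * ‖F x‖) 2 volume)
      (fun _ _ => zero_le) (Finset.mem_univ i)).trans le_add_self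

theorem exists_testFunction_near_schwartz {σ : ℝ} (h0 : 0 ≤ σ) (h1 : 2 * σ ≤ 1) (F : 𝓢(Space N, ℂ))
    (φ : Space N → ℝ) (hF : ∀ x, F x = φ x) {ε : ℝ≥0∞} (hε : ε ≠ 0) :
    ∃ χ : Space N → ℝ, ContDiff ℝ ∞ χ ∧ HasCompactSupport χ ∧ eLpNorm (χ - φ) 2 volume ≤ ε ∧
      eLpNorm (fracLapSymbol σ χ) 2 volume ≤ schwartzEnergy σ F + ε := by
  obtain ⟨A, hA, hcut⟩ := exists_cutoff F φ hF
  have hlim : Tendsto (fun c : ℝ => ENNReal.ofReal c * ((N + 1) * A)) (𝓝[>] 0) (𝓝 0) := by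
    have : Tendsto (fun c : ℝ => ENNReal.ofReal c * ((N + 1) * A)) (𝓝 0) (𝓝 (ENNReal.ofReal 0 * ((N + 1) * A))) :=
      ENNReal.Tendsto.mul_const (ENNReal.continuous_ofReal.tendsto 0)
        (Or.inr (ENNReal.mul_ne_top (by simp) hA))
    rw [ENNReal.ofReal_zero, zero_mul] at this
    exact this.mono_left nhdsWithin_le_nhds
  obtain ⟨c, hcε, hc⟩ := ((hlim.eventually (ge_mem_nhds (pos_iff_ne_zero.2 hε))).and
    self_mem_nhdsWithin).exists
  obtain ⟨χ, G, hχ1, hχ2, hG, hn, hdn⟩ := hcut c hc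
  have hsum : ENNReal.ofReal c * A + ∑ _i : Fin N, ENNReal.ofReal c * A
      = ENNReal.ofReal c * ((N + 1) * A) := by
    rw [Finset.sum_const, Finset.card_univ, Fintype.card_fin, nsmul_eq_mul]
    ring
  refine ⟨χ, hχ1, hχ2, ?_, ?_⟩
  · have : eLpNorm (χ - φ) 2 volume = eLpNorm (G - F : 𝓢(Space N, ℂ)) 2 volume := by
      refine eLpNorm_congr_norm_ae (ae_of_all _ fun x => ?_)
      rw [sub_apply, hG, hF, ← Complex.ofReal_sub, Complex.norm_real]
      rfl
    rw [this]
    refine hn.trans (le_trans ?_ hcε)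
    rw [← hsum]
    exact le_self_add
  · rw [eLpNorm_symbol_schwartz σ hG]
    calc schwartzEnergy σ G = schwartzEnergy σ (F + (G - F)) := by rw [add_sub_cancel]
      _ ≤ schwartzEnergy σ F + schwartzEnergy σ (G - F) := schwartzEnergy_add_le _ _ _
      _ ≤ schwartzEnergy σ F + ε := by
        gcongr
        refine (schwartzEnergy_le h0 h1 _).trans (le_trans ?_ hcε)
        rw [← hsum]
        exact add_le_add hn (Finset.sum_le_sum fun i _ => hdn i)

/-! ### Approximation of H^s functions by test functions -/

/-- Schwartz functions are dense in L²; the plan is to approximate the weighted transform w·𝓕u there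
and to divide by w afterwards. -/
theorem exists_schwartz_near {σ : ℝ} (h0 : 0 < σ) (h1 : 2 * σ ≤ 1) {u : Space N → ℝ}
    (hu : MemLp u 2 volume) (hs : MemLp (fracLapSymbol σ u) 2 volume) {ε : ℝ} (hε : 0 < ε) :
    ∃ F : 𝓢(Space N, ℂ), eLpNorm (fun x => F x - u x) 2 volume ≤ ENNReal.ofReal ε ∧
      schwartzEnergy σ F ≤ eLpNorm (fracLapSymbol σ u) 2 volume
        + ENNReal.ofReal ((2 * Real.pi) ^ (2 * σ)) * ENNReal.ofReal ε := by
  have huC : MemLp (fun x => (u x : ℂ)) 2 volume := hu.ofReal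
  set U : Lp ℂ 2 (volume : Measure (Space N)) := huC.toLp _ with hU
  have hl : l2Fourier u = 𝓕 U := by rw [l2Fourier, dif_pos huC]
  -- Unlike |ξ|^{2σ}, this weight is smooth at the origin and nowhere zero, so its inverse v
  -- multiplies Schwartz functions into Schwartz functions.
  set w : Space N → ℝ := fun ξ => (1 + ‖ξ‖ ^ 2) ^ σ with hw
  set v : Space N → ℝ := fun ξ => (1 + ‖ξ‖ ^ 2) ^ (-σ) with hv
  have hwv : ∀ ξ, v ξ * w ξ = 1 := fun ξ => by
    simp only [hv, hw]
    rw [Real.rpow_neg (by positivity)]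
    exact inv_mul_cancel₀ (Real.rpow_pos_of_pos (by positivity) _).ne'
  have hv0 : ∀ ξ, 0 ≤ v ξ := fun ξ => by positivity
  have hv1 : ∀ ξ, v ξ ≤ 1 := fun ξ =>
    Real.rpow_le_one_of_one_le_of_nonpos (by nlinarith [norm_nonneg ξ]) (by linarith)
  have hn : ∀ ξ : Space N, (‖ξ‖ ^ 2) ^ σ = ‖ξ‖ ^ (2 * σ) := fun ξ => by
    rw [← Real.rpow_natCast, ← Real.rpow_mul (norm_nonneg _)]; norm_num
  have h2pi : ∀ ξ : Space N, ‖(2 * Real.pi) • ξ‖ ^ (2 * σ) = (2 * Real.pi) ^ (2 * σ) * ‖ξ‖ ^ (2 * σ) :=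
    norm_two_pi_smul_rpow σ
  have hwle : ∀ ξ : Space N, w ξ ≤ 1 + ‖(2 * Real.pi) • ξ‖ ^ (2 * σ) := fun ξ => by
    have h := Real.rpow_add_le_add_rpow zero_le_one (sq_nonneg ‖ξ‖) h0.le (by linarith : σ ≤ 1)
    rw [Real.one_rpow, hn] at h
    refine h.trans ?_
    rw [h2pi]
    have h3 : 1 ≤ (2 * Real.pi) ^ (2 * σ) :=
      Real.one_le_rpow (by linarith [Real.pi_gt_three]) (by linarith)
    have h4 : 0 ≤ ‖ξ‖ ^ (2 * σ) := by positivity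
    nlinarith
  have hvle : ∀ ξ : Space N, ‖(2 * Real.pi) • ξ‖ ^ (2 * σ) * v ξ ≤ (2 * Real.pi) ^ (2 * σ) := fun ξ => by
    rw [h2pi, mul_assoc]
    refine mul_le_of_le_one_right (by positivity) ?_
    rw [← hwv ξ, mul_comm]
    refine mul_le_mul_of_nonneg_left ?_ (hv0 ξ)
    rw [← hn]
    exact Real.rpow_le_rpow (by positivity) (by linarith) h0.le
  have hHm : MemLp (fun ξ => (w ξ : ℂ) * l2Fourier u ξ) 2 volume := by
    refine ((Lp.memLp (l2Fourier u)).norm.add hs.norm).mono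
      (AEStronglyMeasurable.mul (Measurable.aestronglyMeasurable (by fun_prop)) (Lp.aestronglyMeasurable _))
      (ae_of_all _ fun ξ => ?_)
    rw [Pi.add_apply, Real.norm_of_nonneg (by positivity), fracLapSymbol, norm_mul, norm_mul, ← one_add_mul,
      Complex.norm_real, Complex.norm_real, Real.norm_of_nonneg (by positivity), Real.norm_of_nonneg (by positivity)]
    exact mul_le_mul_of_nonneg_right (hwle ξ) (norm_nonneg _)
  obtain ⟨ψ, hψ⟩ := (SchwartzMap.denseRange_toLpCLM (F := ℂ) (E := Space N) (p := 2) (μ := volume)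
    ENNReal.ofNat_ne_top).exists_dist_lt (hHm.toLp _) hε
  have hvt : (fun ξ : Space N => ((v ξ : ℝ) : ℂ)).HasTemperateGrowth := by
    have := Function.hasTemperateGrowth_one_add_norm_sq_rpow (H := Space N) (-σ)
    fun_prop
  set g : 𝓢(Space N, ℂ) := SchwartzMap.smulLeftCLM ℂ (fun ξ : Space N => ((v ξ : ℝ) : ℂ)) ψ with hg
  have hgx : ∀ ξ, g ξ = (v ξ : ℂ) * ψ ξ := fun ξ => by
    rw [hg, SchwartzMap.smulLeftCLM_apply_apply hvt, smul_eq_mul]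
  set F : 𝓢(Space N, ℂ) := 𝓕⁻ g with hF
  have hFg : 𝓕 F = g := FourierTransform.fourier_fourierInv_eq g
  have hdist : eLpNorm (fun ξ => (w ξ : ℂ) * l2Fourier u ξ - ψ ξ) 2 volume ≤ ENNReal.ofReal ε := by
    rw [Lp.dist_def] at hψ
    have e : eLpNorm (fun ξ => (w ξ : ℂ) * l2Fourier u ξ - ψ ξ) 2 volume
        = eLpNorm (⇑(hHm.toLp _) - ⇑(SchwartzMap.toLpCLM ℝ ℂ 2 volume ψ)) 2 volume := by
      refine eLpNorm_congr_ae ?_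
      filter_upwards [hHm.coeFn_toLp, ψ.coeFn_toLp 2 volume] with ξ e1 e2
      rw [Pi.sub_apply, e1, SchwartzMap.toLpCLM_apply, e2]
    rw [e, ← ENNReal.ofReal_toReal (a := eLpNorm (⇑(hHm.toLp _) - _) 2 volume)]
    · exact ENNReal.ofReal_le_ofReal hψ.le
    · exact ((Lp.memLp _).sub (Lp.memLp _)).eLpNorm_ne_top
  have hdiff : ∀ ξ, l2Fourier u ξ - g ξ = (v ξ : ℂ) * ((w ξ : ℂ) * l2Fourier u ξ - ψ ξ) := fun ξ => by
    rw [hgx, mul_sub, ← mul_assoc, ← Complex.ofReal_mul, hwv, Complex.ofReal_one, one_mul]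
  refine ⟨F, ?_, ?_⟩
  -- By Plancherel the L² error is that of g - 𝓕u, which equals v times the weighted error up to
  -- sign, and v ≤ 1.
  · have e1 : eLpNorm (fun x => F x - u x) 2 volume = eLpNorm (⇑(F.toLp 2 volume - U)) 2 volume := by
      refine eLpNorm_congr_ae ?_
      filter_upwards [F.coeFn_toLp 2 volume, huC.coeFn_toLp, Lp.coeFn_sub (F.toLp 2 volume) U] with x a b c
      rw [c, Pi.sub_apply, a, b]
    have e2 : ‖F.toLp 2 volume - U‖ = ‖g.toLp 2 volume - l2Fourier u‖ := by
      rw [← Lp.norm_fourier_eq (F.toLp 2 volume - U),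
        show 𝓕 (F.toLp 2 volume - U) = 𝓕 (F.toLp 2 volume) - 𝓕 U from
          map_sub (Lp.fourierTransformₗᵢ (Space N) ℂ) _ _,
        SchwartzMap.toLp_fourier_eq, hFg, hl]
    have e3 : eLpNorm (⇑(F.toLp 2 volume - U)) 2 volume = eLpNorm (⇑(g.toLp 2 volume - l2Fourier u)) 2 volume := by
      rw [Lp.norm_def, Lp.norm_def] at e2
      exact (ENNReal.toReal_eq_toReal_iff' (Lp.eLpNorm_ne_top _) (Lp.eLpNorm_ne_top _)).1 e2
    rw [e1, e3]
    refine le_trans (eLpNorm_mono_ae (g := fun ξ => (w ξ : ℂ) * l2Fourier u ξ - ψ ξ) ?_) hdist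
    filter_upwards [g.coeFn_toLp 2 volume, Lp.coeFn_sub (g.toLp 2 volume) (l2Fourier u)] with ξ a b
    rw [b, Pi.sub_apply, a, norm_sub_rev, hdiff, norm_mul, Complex.norm_real, Real.norm_of_nonneg (hv0 ξ)]
    exact mul_le_of_le_one_left (norm_nonneg _) (hv1 ξ)
  · set D : Space N → ℂ := fun ξ => ((‖(2 * Real.pi) • ξ‖ ^ (2 * σ) : ℝ) : ℂ) * (g ξ - l2Fourier u ξ) with hD
    have e1 : (fun ξ => ((‖(2 * Real.pi) • ξ‖ ^ (2 * σ) : ℝ) : ℂ) * 𝓕 F ξ) = fracLapSymbol σ u + D := by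
      ext ξ
      rw [hFg, Pi.add_apply, hD, fracLapSymbol]
      ring
    rw [schwartzEnergy, e1]
    refine (eLpNorm_add_le hs.aestronglyMeasurable (aestronglyMeasurable_weight_mul σ
      (g.continuous.aestronglyMeasurable.sub (Lp.aestronglyMeasurable _))) one_le_two).trans ?_
    refine add_le_add le_rfl ?_
    refine le_trans (eLpNorm_le_mul_eLpNorm_of_ae_le_mul (c := (2 * Real.pi) ^ (2 * σ))
      (g := fun ξ => (w ξ : ℂ) * l2Fourier u ξ - ψ ξ) (ae_of_all _ fun ξ => ?_) 2) ?_
    · rw [Pi.sub_apply, norm_mul, norm_sub_rev, hdiff, norm_mul, Complex.norm_real, Complex.norm_real,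
        Real.norm_of_nonneg (hv0 ξ), Real.norm_of_nonneg (by positivity), ← mul_assoc]
      exact mul_le_mul_of_nonneg_right (hvle ξ) (norm_nonneg _)
    · gcongr

/-- Test functions are dense in `H^{2σ}`, in a form that suffices for lower semicontinuity arguments. -/
theorem exists_testFunction_near {σ : ℝ} (h0 : 0 < σ) (h1 : 2 * σ ≤ 1) {u : Space N → ℝ}
    (hu : MemLp u 2 volume) (hs : MemLp (fracLapSymbol σ u) 2 volume) {ε : ℝ} (hε : 0 < ε) :
    ∃ χ : Space N → ℝ, ContDiff ℝ ∞ χ ∧ HasCompactSupport χ ∧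
      eLpNorm (χ - u) 2 volume ≤ ENNReal.ofReal ε + ENNReal.ofReal ε ∧
      eLpNorm (fracLapSymbol σ χ) 2 volume ≤ eLpNorm (fracLapSymbol σ u) 2 volume
        + ENNReal.ofReal ((2 * Real.pi) ^ (2 * σ)) * ENNReal.ofReal ε + ENNReal.ofReal ε := by
  obtain ⟨F, hF1, hF2⟩ := exists_schwartz_near h0 h1 hu hs hε
  obtain ⟨χ, c1, c2, c3, c4⟩ := exists_testFunction_near_schwartz h0.le h1 (rePart F) (fun x => (F x).re)
    (rePart_apply F) (ε := ENNReal.ofReal ε) (by simpa using hε)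
  refine ⟨χ, c1, c2, ?_, ?_⟩
  · have hre : Continuous fun x => (F x).re := Complex.continuous_re.comp F.continuous
    have e : χ - u = (χ - fun x => (F x).re) + ((fun x => (F x).re) - u) := by
      ext x; simp
    rw [e]
    refine (eLpNorm_add_le (c1.continuous.aestronglyMeasurable.sub hre.aestronglyMeasurable)
      (hre.aestronglyMeasurable.sub hu.aestronglyMeasurable) one_le_two).trans (add_le_add c3 ?_)
    refine le_trans (eLpNorm_mono fun x => ?_) hF1
    have : ((fun x => (F x).re) - u) x = (F x - u x).re := by simp
    rw [this]
    exact Complex.abs_re_le_norm _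
  · refine c4.trans (add_le_add ((schwartzEnergy_rePart_le σ F).trans hF2) le_rfl)

/-! ### The critical Sobolev inequality on H^s -/

/-- A subsequence converges almost everywhere, and Fatou's lemma makes the L^p norm lower
semicontinuous along it. No convergence in L^p is needed. -/
theorem eLpNorm_le_of_approx {p E C : ℝ≥0∞} {u : Space N → ℝ} {φ : ℕ → Space N → ℝ} {e : ℕ → ℝ≥0∞}
    (hu : AEStronglyMeasurable u volume) (hφ : ∀ n, AEStronglyMeasurable (φ n) volume)
    (hL : Tendsto (fun n => eLpNorm (φ n - u) 2 volume) atTop (𝓝 0)) (hC : C ≠ ⊤)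
    (hle : ∀ n, eLpNorm (φ n) p volume ≤ C * e n) (he : Tendsto e atTop (𝓝 E)) :
    eLpNorm u p volume ≤ C * E := by
  obtain ⟨ns, hns, hae⟩ :=
    (tendstoInMeasure_of_tendsto_eLpNorm two_ne_zero hφ hu hL).exists_seq_tendsto_ae
  have h1 := Lp.eLpNorm_lim_le_liminf_eLpNorm (p := p) (fun n => hφ (ns n)) u hae
  have h2 : Tendsto (fun n => C * e (ns n)) atTop (𝓝 (C * E)) :=
    ENNReal.Tendsto.const_mul (he.comp hns.tendsto_atTop) (Or.inr hC)
  rw [← h2.liminf_eq]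
  exact h1.trans (liminf_le_liminf (Eventually.of_forall fun n => hle _))

theorem sobolevConst_nonneg (N : ℕ) (s : ℝ) : 0 ≤ sobolevConst N s := by
  refine Real.sInf_nonneg ?_
  rintro r ⟨u, w, -, -, rfl⟩
  positivity

theorem memLp_symbol_testFunction {σ : ℝ} (h0 : 0 ≤ σ) (h1 : 2 * σ ≤ 1) {φ : Space N → ℝ}
    (hd : ContDiff ℝ ∞ φ) (hc : HasCompactSupport φ) : MemLp (fracLapSymbol σ φ) 2 volume := by
  have hc' : HasCompactSupport (fun x => (φ x : ℂ)) := hc.comp_left (g := Complex.ofReal) (by simp)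
  have hd' : ContDiff ℝ ∞ (fun x => (φ x : ℂ)) := Complex.ofRealCLM.contDiff.comp hd
  set G : 𝓢(Space N, ℂ) := hc'.toSchwartzMap hd' with hG
  have hGx : ∀ x, G x = φ x := fun x => rfl
  refine ⟨aestronglyMeasurable_weight_mul σ (Lp.aestronglyMeasurable _), ?_⟩
  rw [eLpNorm_symbol_schwartz σ hGx]
  refine (schwartzEnergy_le h0 h1 G).trans_lt ?_
  refine ENNReal.add_lt_top.2 ⟨(G.memLp 2 volume).eLpNorm_lt_top, ENNReal.sum_lt_top.2 fun i _ => ?_⟩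
  exact (SchwartzMap.memLp _ 2 volume).eLpNorm_lt_top

theorem critExp_pos {s : ℝ} (hs : 0 < s) (hN : 2 * s < N) : 0 < critExp N s :=
  div_pos (by linarith) (by linarith)

theorem sobolev_testFunction {s : ℝ} (hs0 : 0 < s) (hs1 : s < 1) (hN : 2 * s < N)
    (hS : 0 < sobolevConst N s) {φ : Space N → ℝ} (hd : ContDiff ℝ ∞ φ) (hc : HasCompactSupport φ) :
    eLpNorm φ (ENNReal.ofReal (critExp N s)) volume
      ≤ ENNReal.ofReal (√(sobolevConst N s))⁻¹ * eLpNorm (fracLapSymbol (s / 2) φ) 2 volume := by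
  set p := ENNReal.ofReal (critExp N s) with hp
  have hp0 : p ≠ 0 := by simpa [hp] using critExp_pos hs0 hN
  by_cases hz : φ =ᵐ[volume] 0
  · rw [eLpNorm_congr_ae hz, eLpNorm_zero]
    exact zero_le
  have hm : MemLp φ p volume := hd.continuous.memLp_of_hasCompactSupport hc
  have hsym := memLp_symbol_testFunction (σ := s / 2) (by linarith) (by linarith) hd hc
  have hle : sobolevConst N s ≤ ‖fracLap (s / 2) φ‖ ^ 2 / lpNorm φ p volume ^ 2 := by
    -- The constant sequence φ shows that a test function lies in D^{s,2}.
    refine csInf_le ⟨0, ?_⟩ ⟨φ, fracLap (s / 2) φ, ⟨hm, fun _ => φ, fun _ => ⟨hd, hc⟩, ?_, tendsto_const_nhds⟩,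
      hz, rfl⟩
    · rintro r ⟨u, w, -, -, rfl⟩
      positivity
    · simp
  have hpos : 0 < lpNorm φ p volume :=
    lt_of_le_of_ne lpNorm_nonneg fun h => hz ((lpNorm_eq_zero hm hp0).1 h.symm)
  rw [le_div_iff₀ (by positivity)] at hle
  have h2 : √(sobolevConst N s) * lpNorm φ p volume ≤ ‖fracLap (s / 2) φ‖ := by
    rw [← Real.sqrt_sq (norm_nonneg (fracLap (s / 2) φ)), ← Real.sqrt_sq hpos.le, ← Real.sqrt_mul hS.le]
    exact Real.sqrt_le_sqrt hle
  rw [← ofReal_lpNorm hm, ← ENNReal.ofReal_toReal hsym.eLpNorm_ne_top, ← norm_fracLap hsym,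
    ← ENNReal.ofReal_mul (by positivity)]
  refine ENNReal.ofReal_le_ofReal ?_
  rw [inv_mul_eq_div, le_div_iff₀ (Real.sqrt_pos.2 hS), mul_comm]
  exact h2

/-- The critical Sobolev inequality on `H^s`. -/
theorem sobolev_memHs {s : ℝ} (hs0 : 0 < s) (hs1 : s < 1) (hN : 2 * s < N)
    (hS : 0 < sobolevConst N s) {u : Space N → ℝ} (hu : MemHs s u) :
    MemLp u (ENNReal.ofReal (critExp N s)) volume ∧
      sobolevConst N s * lpNorm u (ENNReal.ofReal (critExp N s)) volume ^ 2 ≤ ‖fracLap (s / 2) u‖ ^ 2 := by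
  have hsym := hu.memLp_symbol
  have hε : ∀ n : ℕ, (0 : ℝ) < 1 / ((n : ℝ) + 1) := fun n => by positivity
  choose φ h1 h2 h3 h4 using fun n : ℕ =>
    exists_testFunction_near (σ := s / 2) (by linarith) (by linarith) hu.1 hsym (hε n)
  have ht : Tendsto (fun n : ℕ => ENNReal.ofReal (1 / ((n : ℝ) + 1))) atTop (𝓝 0) := by
    rw [← ENNReal.ofReal_zero]
    exact ENNReal.tendsto_ofReal tendsto_one_div_add_atTop_nhds_zero_nat
  have key := eLpNorm_le_of_approx (p := ENNReal.ofReal (critExp N s))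
    (C := ENNReal.ofReal (√(sobolevConst N s))⁻¹) (E := eLpNorm (fracLapSymbol (s / 2) u) 2 volume)
    hu.1.aestronglyMeasurable (fun n => (h1 n).continuous.aestronglyMeasurable)
    (tendsto_of_tendsto_of_tendsto_of_le_of_le tendsto_const_nhds (by simpa using ht.add ht)
      (fun _ => zero_le) h3) ENNReal.ofReal_ne_top
    (fun n => (sobolev_testFunction hs0 hs1 hN hS (h1 n) (h2 n)).trans (mul_le_mul_right (h4 n) _))
    (by
      have := (ENNReal.Tendsto.const_mul ht (Or.inr (ENNReal.ofReal_ne_top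
        (r := (2 * Real.pi) ^ (2 * (s / 2)))))).const_add (eLpNorm (fracLapSymbol (s / 2) u) 2 volume)
      simpa using this.add ht)
  have hm : MemLp u (ENNReal.ofReal (critExp N s)) volume :=
    ⟨hu.1.aestronglyMeasurable, key.trans_lt (ENNReal.mul_lt_top ENNReal.ofReal_lt_top hsym.eLpNorm_lt_top)⟩
  refine ⟨hm, ?_⟩
  rw [← ofReal_lpNorm hm, ← ENNReal.ofReal_toReal hsym.eLpNorm_ne_top, ← norm_fracLap hsym,
    ← ENNReal.ofReal_mul (by positivity),
    ENNReal.ofReal_le_ofReal_iff (mul_nonneg (by positivity) (norm_nonneg _)),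
    inv_mul_eq_div, le_div_iff₀ (Real.sqrt_pos.2 hS)] at key
  calc sobolevConst N s * lpNorm u (ENNReal.ofReal (critExp N s)) volume ^ 2
      = (lpNorm u (ENNReal.ofReal (critExp N s)) volume * √(sobolevConst N s)) ^ 2 := by
        rw [mul_pow, Real.sq_sqrt hS.le, mul_comm]
    _ ≤ _ := pow_le_pow_left₀ (mul_nonneg lpNorm_nonneg (Real.sqrt_nonneg _)) key 2

/-! ### Interpolation, explicit constants and the optimal radius -/

/-- Interpolation (Lyapunov's inequality) between `L^p` and `L^r`. -/
theorem eLpNorm_interpolation {α : Type*} [MeasurableSpace α] {μ : Measure α} {u : α → ℝ}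
    (hu : AEStronglyMeasurable u μ) {p r q θ : ℝ} (hp : 0 < p) (hr : 0 < r) (hq : 0 < q)
    (h0 : 0 ≤ θ) (h1 : θ ≤ 1) (h : 1 / q = θ / p + (1 - θ) / r) :
    eLpNorm u (ENNReal.ofReal q) μ
      ≤ eLpNorm u (ENNReal.ofReal p) μ ^ θ * eLpNorm u (ENNReal.ofReal r) μ ^ (1 - θ) := by
  -- Hölder for |u|^q = (|u|^p)^{qθ/p} (|u|^r)^{q(1-θ)/r}; the relation between q, p, r and θ says
  -- that these two exponents sum to 1.
  have key := ENNReal.lintegral_mul_norm_pow_le (μ := μ) (f := fun x => ‖u x‖ₑ ^ p) (g := fun x => ‖u x‖ₑ ^ r)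
    (p := q * θ / p) (q := q * (1 - θ) / r) (by fun_prop) (by fun_prop) (by positivity)
    (div_nonneg (mul_nonneg hq.le (by linarith)) hr.le) (by field_simp at h ⊢; linarith)
  have e : ∀ x, (‖u x‖ₑ ^ p) ^ (q * θ / p) * (‖u x‖ₑ ^ r) ^ (q * (1 - θ) / r) = ‖u x‖ₑ ^ q := fun x => by
    rw [← ENNReal.rpow_mul, ← ENNReal.rpow_mul, ← ENNReal.rpow_add_of_nonneg]
    · congr 1
      field_simp
      ring
    · positivity
    · exact mul_nonneg hr.le (div_nonneg (mul_nonneg hq.le (by linarith)) hr.le)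
  simp_rw [e] at key
  rw [eLpNorm_eq_lintegral_rpow_enorm_toReal (by simpa using hq) ENNReal.ofReal_ne_top,
    eLpNorm_eq_lintegral_rpow_enorm_toReal (by simpa using hp) ENNReal.ofReal_ne_top,
    eLpNorm_eq_lintegral_rpow_enorm_toReal (by simpa using hr) ENNReal.ofReal_ne_top,
    ENNReal.toReal_ofReal hq.le, ENNReal.toReal_ofReal hp.le, ENNReal.toReal_ofReal hr.le]
  refine (ENNReal.rpow_le_rpow key (by positivity : 0 ≤ 1 / q)).trans_eq ?_
  rw [ENNReal.mul_rpow_of_nonneg _ _ (by positivity), ← ENNReal.rpow_mul, ← ENNReal.rpow_mul, ← ENNReal.rpow_mul,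
    ← ENNReal.rpow_mul]
  congr 2 <;> field_simp

theorem one_div_critExp {s : ℝ} (hN : 2 * s < N) (hs : 0 < s) : 1 / critExp N s = 1 / 2 - s / N := by
  have : (0 : ℝ) < N := by linarith
  have : (N : ℝ) - 2 * s ≠ 0 := by linarith
  rw [critExp]
  field_simp

/-- `‖(-Δ)^{s/2} v‖²` is at most `bumpEnergy N s * R ^ (2s + N)`, where `v = bump s R x₀`. -/
noncomputable def bumpEnergy (N : ℕ) (s : ℝ) : ℝ := energyConst N s / (s + N / 2)

/-- `∫ v ^ q = bumpMass N (q * s) * R ^ (N + 2qs)`, where `v = bump s R x₀`. -/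
noncomputable def bumpMass (N : ℕ) (a : ℝ) : ℝ :=
  N * unitBallVol N / 2 * ProbabilityTheory.beta (N / 2) (a + 1)

theorem bumpEnergy_pos (hN : 0 < N) {s : ℝ} (hs : 0 < s) : 0 < bumpEnergy N s := by
  have := unitBallVol_pos (N := N)
  have : 0 < Real.Gamma (s + 1) := Real.Gamma_pos_of_pos (by linarith)
  have : (0 : ℝ) < N := by exact_mod_cast hN
  unfold bumpEnergy energyConst
  positivity

theorem bumpMass_pos (hN : 0 < N) {a : ℝ} (ha : 0 < a) : 0 < bumpMass N a := by
  have := unitBallVol_pos (N := N)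
  have h : (0 : ℝ) < N := by exact_mod_cast hN
  have := ProbabilityTheory.beta_pos (α := (N : ℝ) / 2) (β := a + 1) (by positivity) (by linarith)
  unfold bumpMass
  positivity

theorem bump_energy_le (hN : 0 < N) {s R : ℝ} (hs : 0 < s) (hR : 0 < R) (x₀ : Space N) :
    ‖fracLap (s / 2) (bump s R x₀)‖ ^ 2 ≤ bumpEnergy N s * R ^ (2 * s + N) :=
  (bump_energy hN hs hR x₀).2.trans_eq (by rw [bumpEnergy]; ring)

theorem lpNorm_bump_sq (hN : 0 < N) {s q R : ℝ} (hs : 0 < s) (hq : 0 < q) (hR : 0 < R) (x₀ : Space N) :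
    lpNorm (bump s R x₀) (ENNReal.ofReal q) volume ^ 2
      = bumpMass N (q * s) ^ (2 / q) * R ^ (2 * N / q + 4 * s) := by
  have hm := bumpMass_pos hN (mul_pos hq hs)
  rw [lpNorm_bump hN hs hq hR, ← bumpMass, Real.mul_rpow hm.le (by positivity), mul_pow,
    ← Real.rpow_natCast (bumpMass N (q * s) ^ (1 / q)), ← Real.rpow_natCast ((R ^ _) ^ (1 / q)),
    ← Real.rpow_mul hm.le, ← Real.rpow_mul hR.le, ← Real.rpow_mul hR.le]
  congr 2
  · push_cast; ring
  · push_cast; field_simp; ring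

theorem bumpMass_rpow (hN : 0 < N) {a : ℝ} (ha : 0 < a) (x : ℝ) :
    bumpMass N a ^ x = (unitBallVol N * N) ^ x * 2 ^ (-x) * ProbabilityTheory.beta (N / 2) (a + 1) ^ x := by
  have := unitBallVol_pos (N := N)
  have h : (0 : ℝ) < N := by exact_mod_cast hN
  have := ProbabilityTheory.beta_pos (α := (N : ℝ) / 2) (β := a + 1) (by positivity) (by linarith)
  rw [bumpMass, Real.mul_rpow (by positivity) (by positivity), Real.div_rpow (by positivity) (by norm_num),
    Real.rpow_neg (by norm_num), mul_comm (N : ℝ), div_eq_mul_inv]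

theorem domain_ratio_eq (hN : 0 < N) {s q : ℝ} (hs : 0 < s) (hq : 0 < q) {R : ℝ} (hR : 0 < R) :
    bumpEnergy N s * R ^ (2 * s + N) / (bumpMass N (q * s) ^ (2 / q) * R ^ (2 * N / q + 4 * s))
      = (2 : ℝ) ^ (2 * s + 2 / q) * (unitBallVol N * N) ^ (1 - 2 / q)
              / (N + 2 * s) * Real.Gamma (s + 1) ^ 2
            * (ProbabilityTheory.beta ((N : ℝ) / 2) (q * s + 1)) ^ (-(2 / q))
            * R ^ (2 * N * ((1 / 2 - s / N) - 1 / q)) := by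
  have hω := unitBallVol_pos (N := N)
  have h : (0 : ℝ) < N := by exact_mod_cast hN
  have hB := ProbabilityTheory.beta_pos (α := (N : ℝ) / 2) (β := q * s + 1) (by positivity) (by positivity)
  rw [bumpMass_rpow hN (mul_pos hq hs), bumpEnergy, energyConst, Real.rpow_add two_pos, Real.rpow_sub (by positivity),
    Real.rpow_one, Real.rpow_neg hB.le, Real.rpow_neg two_pos.le,
    show 2 * N * ((1 / 2 - s / N) - 1 / q) = (2 * s + N) - (2 * N / q + 4 * s) by field_simp; ring,
    Real.rpow_sub hR]
  field_simp
  ring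

/-- Value of the quotient `(a R^{2s+N} + b R^{N+4s}) / (d R^{2N/q+4s})` at the optimal radius. -/
theorem exists_optimal_radius {n s q a b d θ : ℝ} (hs : 0 < s) (ha : 0 < a) (hb : 0 < b) (hd : 0 < d)
    (hθ0 : 0 < θ) (hθ1 : θ < 1) (hθ : n * (1 - 2 / q) = 2 * s * (1 - θ)) :
    ∃ R : ℝ, 0 < R ∧ (a * R ^ (2 * s + n) + b * R ^ (n + 4 * s)) / (d * R ^ (2 * n / q + 4 * s))
      = (a / (1 - θ)) ^ (1 - θ) * (b / θ) ^ θ / d := by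
  have h1 : 0 < 1 - θ := by linarith
  -- In the variable τ = R^{2s} the quotient is (a τ^{-θ} + b τ^{1-θ}) / d, whose critical point is
  -- this value.
  set τ := a * θ / (b * (1 - θ)) with hτ
  have hτ0 : 0 < τ := by positivity
  have hR : 0 < τ ^ (1 / (2 * s)) := Real.rpow_pos_of_pos hτ0 _
  refine ⟨τ ^ (1 / (2 * s)), hR, ?_⟩
  set R := τ ^ (1 / (2 * s)) with hRdef
  have hRτ : R ^ (2 * s) = τ := by
    rw [hRdef, ← Real.rpow_mul hτ0.le]
    field_simp
    exact Real.rpow_one τ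
  have hR1 : R ^ (n + 4 * s) = R ^ (2 * n / q + 4 * s) * τ ^ (1 - θ) := by
    rw [← hRτ, ← Real.rpow_mul hR.le, ← hθ, ← Real.rpow_add hR]
    ring_nf
  have hR2 : R ^ (2 * s + n) = R ^ (2 * n / q + 4 * s) * τ ^ (1 - θ) * τ⁻¹ := by
    rw [← hR1, ← Real.rpow_neg_one τ, ← hRτ, ← Real.rpow_mul hR.le, ← Real.rpow_add hR]
    ring_nf
  have hX : 0 < R ^ (2 * n / q + 4 * s) := Real.rpow_pos_of_pos hR _
  rw [hR1, hR2]
  have e1 : (a * (R ^ (2 * n / q + 4 * s) * τ ^ (1 - θ) * τ⁻¹) + b * (R ^ (2 * n / q + 4 * s) * τ ^ (1 - θ)))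
      / (d * R ^ (2 * n / q + 4 * s)) = τ ^ (1 - θ) * (a * τ⁻¹ + b) / d := by
    field_simp
  have e2 : a * τ⁻¹ + b = b / θ := by
    rw [hτ]; field_simp; ring
  have e3 : τ ^ (1 - θ) = (a / (1 - θ)) ^ (1 - θ) * ((b / θ) ^ (1 - θ))⁻¹ := by
    rw [← Real.inv_rpow (by positivity), ← Real.mul_rpow (by positivity) (by positivity), hτ]
    congr 1
    field_simp
  have e4 : (b / θ) ^ θ = ((b / θ) ^ (1 - θ))⁻¹ * (b / θ) := by
    rw [← Real.rpow_neg (by positivity)]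
    nth_rewrite 3 [← Real.rpow_one (b / θ)]
    rw [← Real.rpow_add (by positivity)]
    ring_nf
  rw [e1, e2, e3, e4]
  ring

/-- The factors ω_N s occur with exponents 1 - θ and θ, hence recombine to ω_N s; the powers of 2
match through 2s(1 - θ)/N = 1 - 2/q. -/
theorem wholeSpace_bound_eq (hN : 0 < N) {s q θ : ℝ} (hs : 0 < s) (hq : 0 < q)
    (hθ0 : 0 < θ) (hθ1 : θ < 1) (hθ : N * (1 - 2 / q) = 2 * s * (1 - θ)) :
    (bumpEnergy N s / (1 - θ)) ^ (1 - θ) * (bumpMass N (2 * s) / θ) ^ θ / bumpMass N (q * s) ^ (2 / q)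
      = (unitBallVol N) ^ (1 - 2 / q) * s
          * ((2 : ℝ) ^ (2 * s + 1 - 2 * s / N) * Real.Gamma (s + 1) ^ 2
              / ((N + 2 * s) * ((1 - θ) * s / N))) ^ (1 - θ)
          * (N * ProbabilityTheory.beta ((N : ℝ) / 2) (q * s + 1)) ^ (-(2 / q))
          * (ProbabilityTheory.beta ((N : ℝ) / 2) (2 * s + 1) / (θ * s / N)) ^ θ := by
  have hω := unitBallVol_pos (N := N)
  have h : (0 : ℝ) < N := by exact_mod_cast hN
  have hB := ProbabilityTheory.beta_pos (α := (N : ℝ) / 2) (β := q * s + 1) (by positivity) (by positivity)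
  have hB2 := ProbabilityTheory.beta_pos (α := (N : ℝ) / 2) (β := 2 * s + 1) (by positivity) (by positivity)
  have hG : 0 < Real.Gamma (s + 1) := Real.Gamma_pos_of_pos (by linarith)
  have h1 : 0 < 1 - θ := by linarith
  have hns : (0 : ℝ) < N + 2 * s := by positivity
  set Y := Real.Gamma (s + 1) ^ 2 / ((N + 2 * s) * ((1 - θ) * s / N)) with hY
  set Z := ProbabilityTheory.beta ((N : ℝ) / 2) (2 * s + 1) / (θ * s / N) with hZ
  have hY0 : 0 < Y := by positivity
  have hZ0 : 0 < Z := by positivity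
  have e1 : bumpEnergy N s / (1 - θ) = 2 ^ (2 * s) * Y * (unitBallVol N * s) := by
    rw [bumpEnergy, energyConst, hY]; field_simp; ring
  have e2 : bumpMass N (2 * s) / θ = Z * (unitBallVol N * s) * 2⁻¹ := by
    rw [bumpMass, hZ]; field_simp
  have e3 : (2 : ℝ) ^ (2 * s + 1 - 2 * s / N) * Real.Gamma (s + 1) ^ 2 / ((N + 2 * s) * ((1 - θ) * s / N))
      = 2 ^ (2 * s + 1 - 2 * s / N) * Y := by
    rw [hY]; ring
  rw [e1, e2, e3, bumpMass_rpow hN (mul_pos hq hs)]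
  set B := ProbabilityTheory.beta ((N : ℝ) / 2) (q * s + 1) with hBdef
  clear_value Y Z B
  have hNθ : 2 * s / N * (1 - θ) = 1 - 2 / q := by
    field_simp at hθ ⊢
    linarith
  have p1 : ((2 : ℝ) ^ (2 * s) * Y * (unitBallVol N * s)) ^ (1 - θ)
      = 2 ^ (2 * s * (1 - θ)) * Y ^ (1 - θ) * (unitBallVol N * s) ^ (1 - θ) := by
    rw [Real.mul_rpow (by positivity) (by positivity), Real.mul_rpow (by positivity) (by positivity),
      ← Real.rpow_mul two_pos.le]
  have p2 : (Z * (unitBallVol N * s) * 2⁻¹) ^ θ = Z ^ θ * (unitBallVol N * s) ^ θ * 2 ^ (-θ) := by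
    rw [Real.mul_rpow (by positivity) (by positivity), Real.mul_rpow (by positivity) (by positivity),
      Real.inv_rpow two_pos.le, Real.rpow_neg two_pos.le]
  have p3 : ((2 : ℝ) ^ (2 * s + 1 - 2 * s / N) * Y) ^ (1 - θ)
      = 2 ^ (2 * s * (1 - θ)) * 2 ^ (-θ) * 2 ^ (2 / q) * Y ^ (1 - θ) := by
    rw [Real.mul_rpow (by positivity) (by positivity), ← Real.rpow_mul two_pos.le, ← Real.rpow_add two_pos,
      ← Real.rpow_add two_pos]
    congr 2
    linear_combination -hNθ
  have p4 : (unitBallVol N * s) ^ (1 - θ) * (unitBallVol N * s) ^ θ = unitBallVol N * s := by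
    rw [← Real.rpow_add (by positivity), sub_add_cancel, Real.rpow_one]
  have p5 : (unitBallVol N) ^ (1 - 2 / q) = unitBallVol N * (unitBallVol N ^ (2 / q))⁻¹ := by
    rw [Real.rpow_sub hω, Real.rpow_one, div_eq_mul_inv]
  rw [p1, p2, p3, p5, Real.rpow_neg (mul_pos h hB).le, Real.rpow_neg two_pos.le (2 / q), Real.mul_rpow hω.le h.le,
    Real.mul_rpow h.le hB.le]
  have q1 : 0 < (2 : ℝ) ^ (2 / q) := by positivity
  have q2 : 0 < (unitBallVol N) ^ (2 / q) := by positivity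
  have q3 : 0 < (N : ℝ) ^ (2 / q) := by positivity
  have q4 : 0 < B ^ (2 / q) := by positivity
  generalize (unitBallVol N * s) ^ (1 - θ) = P₁ at p4 ⊢
  generalize (unitBallVol N * s) ^ θ = P₂ at p4 ⊢
  field_simp
  linear_combination p4

/-! ### Bounds for the best constants -/

theorem lpNorm_pos {α : Type*} [MeasurableSpace α] {μ : Measure α} {u : α → ℝ} {p : ℝ≥0∞}
    (hu : MemLp u p μ) (hp : p ≠ 0) (h : ¬ u =ᵐ[μ] 0) : 0 < lpNorm u p μ :=
  lt_of_le_of_ne lpNorm_nonneg fun h0 => h ((lpNorm_eq_zero hu hp).1 h0.symm)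

theorem domainConst_le_bump (hN : 0 < N) {s q : ℝ} (hs : 0 < s) (hq : 0 < q) {Ω : Set (Space N)}
    (hΩ : IsOpen Ω) {R : ℝ} (hR : 0 < R) {x₀ : Space N} (h : Metric.ball x₀ R ⊆ Ω) :
    domainConst s q Ω ≤ bumpEnergy N s * R ^ (2 * s + N)
      / (bumpMass N (q * s) ^ (2 / q) * R ^ (2 * N / q + 4 * s)) := by
  refine le_trans (csInf_le ⟨0, ?_⟩ ⟨bump s R x₀, ⟨(bump_energy hN hs hR x₀).1, ae_of_all _ fun x hx =>
    bump_eq_zero hs hR.le fun hb => hx (h hb)⟩, not_bump_ae_eq_zero hs hR x₀, rfl⟩) ?_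
  · rintro r ⟨u, -, -, rfl⟩
    positivity
  · rw [lpNorm_restrict_bump hs hR.le hΩ h, lpNorm_bump_sq hN hs hq hR]
    have := bumpMass_pos hN (mul_pos hq hs)
    gcongr
    exact bump_energy_le hN hs hR x₀

theorem wholeSpaceConst_le_bump (hN : 0 < N) {s q : ℝ} (hs : 0 < s) (hq : 0 < q) {R : ℝ} (hR : 0 < R) :
    wholeSpaceConst N s q ≤ (bumpEnergy N s * R ^ (2 * s + N) + bumpMass N (2 * s) * R ^ (N + 4 * s))
      / (bumpMass N (q * s) ^ (2 / q) * R ^ (2 * N / q + 4 * s)) := by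
  refine le_trans (csInf_le ⟨0, ?_⟩ ⟨bump s R 0, (bump_energy hN hs hR 0).1,
    not_bump_ae_eq_zero hs hR 0, rfl⟩) ?_
  · rintro r ⟨u, -, -, rfl⟩
    positivity
  · have h2 := lpNorm_bump_sq hN hs two_pos hR (0 : Space N)
    rw [ENNReal.ofReal_ofNat, div_self two_ne_zero, Real.rpow_one,
      show 2 * (N : ℝ) / 2 + 4 * s = N + 4 * s by ring] at h2
    rw [lpNorm_bump_sq hN hs hq hR, h2]
    have := bumpMass_pos hN (mul_pos hq hs)
    gcongr
    exact bump_energy_le hN hs hR 0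

theorem radii_nonempty {Ω : Set (Space N)} (hΩ : IsOpen Ω) (hne : Ω.Nonempty) :
    {R : ℝ | 0 < R ∧ ∃ x ∈ Ω, Metric.ball x R ⊆ Ω}.Nonempty := by
  obtain ⟨x, hx⟩ := hne
  obtain ⟨R, hR, h⟩ := Metric.isOpen_iff.1 hΩ x hx
  exact ⟨R, hR, x, hx, h⟩

theorem radii_bddAbove (hN : 0 < N) {Ω : Set (Space N)} (hb : Bornology.IsBounded Ω) :
    BddAbove {R : ℝ | 0 < R ∧ ∃ x ∈ Ω, Metric.ball x R ⊆ Ω} := by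
  obtain ⟨M, hM⟩ := hb.exists_norm_le
  refine ⟨2 * M, ?_⟩
  rintro R ⟨hR, x, hx, h⟩
  -- The ball is open, so only points at distance t < R from its centre are available. Two points of
  -- Ω at distance t give t ≤ 2M.
  refine le_of_forall_lt_imp_le_of_dense fun t ht => ?_
  rcases le_or_gt t 0 with h0 | h0
  · linarith [(norm_nonneg x).trans (hM x hx)]
  · set v : Space N := EuclideanSpace.single ⟨0, hN⟩ t with hv
    have hvn : ‖v‖ = t := by simp [hv, abs_of_pos h0]
    have h1 := hM (x + v) (h (by rw [Metric.mem_ball, dist_eq_norm, add_sub_cancel_left, hvn]; exact ht))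
    have h2 : ‖v‖ ≤ ‖x + v‖ + ‖x‖ := by
      have := norm_sub_le (x + v) x
      rwa [add_sub_cancel_left] at this
    linarith [hM x hx]

theorem domainConst_le {s q : ℝ} (hs : 0 < s) (hN : 2 * s < N) (hq : 0 < q) {Ω : Set (Space N)}
    (hΩ : IsOpen Ω) (hne : Ω.Nonempty) (hb : Bornology.IsBounded Ω) :
    domainConst s q Ω
          ≤ (2 : ℝ) ^ (2 * s + 2 / q) * (unitBallVol N * N) ^ (1 - 2 / q)
              / (N + 2 * s) * Real.Gamma (s + 1) ^ 2
            * (ProbabilityTheory.beta ((N : ℝ) / 2) (q * s + 1)) ^ (-(2 / q))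
            * (inradius Ω) ^ (2 * N * (1 / critExp N s - 1 / q)) := by
  have hN' : 0 < N := by exact_mod_cast (by linarith : (0 : ℝ) < N)
  have hne' := radii_nonempty hΩ hne
  have hbd := radii_bddAbove hN' hb
  -- Admissible radii tending to the supremum suffice, because the bound is continuous in R at the
  -- positive inradius; attainment is not needed.
  obtain ⟨R, -, hlim, hR⟩ := exists_seq_tendsto_sSup hne' hbd
  have hpos : 0 < inradius Ω := by
    obtain ⟨r, hr⟩ := hne'
    exact hr.1.trans_le (le_csSup hbd hr)
  rw [one_div_critExp hN hs]
  refine ge_of_tendsto' ((hlim.rpow_const (p := 2 * N * ((1 / 2 - s / N) - 1 / q)) (Or.inl hpos.ne')).const_mul _)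
    fun n => ?_
  obtain ⟨hRn, x, -, hball⟩ := hR n
  rw [← domain_ratio_eq hN' hs hq hRn]
  exact domainConst_le_bump hN' hs hq hΩ hRn hball

theorem le_domainConst {s q : ℝ} (hs : 0 < s) (hs1 : s < 1) (hN : 2 * s < N) (hq1 : 1 ≤ q)
    (hq : q < critExp N s) {Ω : Set (Space N)} (hΩ : IsOpen Ω) (hne : Ω.Nonempty)
    (hb : Bornology.IsBounded Ω) :
    sobolevConst N s * (volume.real Ω) ^ (2 * (1 / critExp N s - 1 / q)) ≤ domainConst s q Ω := by
  have hN' : 0 < N := by exact_mod_cast (by linarith : (0 : ℝ) < N)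
  have hq0 : 0 < q := by linarith
  have hp0 : 0 < critExp N s := critExp_pos hs hN
  have hfin : volume Ω ≠ ⊤ := hb.measure_lt_top.ne
  have hvol : 0 < volume.real Ω := ENNReal.toReal_pos (hΩ.measure_pos volume hne).ne' hfin
  refine le_csInf ?_ ?_
  · obtain ⟨R, hR, x, -, h⟩ := radii_nonempty hΩ hne
    exact ⟨_, bump s R x, ⟨(bump_energy hN' hs hR x).1, ae_of_all _ fun y hy =>
      bump_eq_zero hs hR.le fun hy' => hy (h hy')⟩, not_bump_ae_eq_zero hs hR x, rfl⟩
  rintro r ⟨u, ⟨hu, hu0⟩, hnz, rfl⟩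
  rcases (sobolevConst_nonneg N s).eq_or_lt with hS | hS
  · rw [← hS, zero_mul]
    positivity
  obtain ⟨hm, hsob⟩ := sobolev_memHs hs hs1 hN hS hu
  have hle : eLpNorm u (ENNReal.ofReal q) (volume.restrict Ω)
      ≤ eLpNorm u (ENNReal.ofReal (critExp N s)) volume
        * ENNReal.ofReal ((volume.real Ω) ^ (1 / q - 1 / critExp N s)) := by
    refine (eLpNorm_le_eLpNorm_mul_rpow_measure_univ (q := ENNReal.ofReal (critExp N s))
      (ENNReal.ofReal_le_ofReal hq.le) hm.aestronglyMeasurable.restrict).trans ?_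
    rw [Measure.restrict_apply_univ, ENNReal.toReal_ofReal hq0.le, ENNReal.toReal_ofReal hp0.le,
      ← ENNReal.ofReal_rpow_of_pos hvol, Measure.real, ENNReal.ofReal_toReal hfin]
    exact mul_le_mul_left (eLpNorm_mono_measure u Measure.restrict_le_self) _
  have hmq : MemLp u (ENNReal.ofReal q) (volume.restrict Ω) :=
    ⟨hm.aestronglyMeasurable.restrict, hle.trans_lt (ENNReal.mul_lt_top hm.eLpNorm_lt_top ENNReal.ofReal_lt_top)⟩
  have hle' : lpNorm u (ENNReal.ofReal q) (volume.restrict Ω)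
      ≤ lpNorm u (ENNReal.ofReal (critExp N s)) volume * (volume.real Ω) ^ (1 / q - 1 / critExp N s) := by
    rw [← ofReal_lpNorm hmq, ← ofReal_lpNorm hm, ← ENNReal.ofReal_mul lpNorm_nonneg] at hle
    exact (ENNReal.ofReal_le_ofReal_iff (mul_nonneg lpNorm_nonneg (by positivity))).1 hle
  -- A function vanishing almost everywhere both on Ω and outside Ω would be zero.
  have hpos : 0 < lpNorm u (ENNReal.ofReal q) (volume.restrict Ω) := by
    refine lpNorm_pos hmq (by simpa using hq0) fun h => hnz ?_
    filter_upwards [(ae_restrict_iff' hΩ.measurableSet).1 h, hu0] with x h1 h2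
    by_cases hx : x ∈ Ω
    · exact h1 hx
    · exact h2 hx
  rw [le_div_iff₀ (by positivity)]
  have e : (volume.real Ω) ^ (2 * (1 / critExp N s - 1 / q))
      * ((volume.real Ω) ^ (1 / q - 1 / critExp N s)) ^ 2 = 1 := by
    rw [← Real.rpow_natCast, ← Real.rpow_mul hvol.le, ← Real.rpow_add hvol]
    push_cast
    ring_nf
    exact Real.rpow_zero _
  calc sobolevConst N s * (volume.real Ω) ^ (2 * (1 / critExp N s - 1 / q))
        * lpNorm u (ENNReal.ofReal q) (volume.restrict Ω) ^ 2
      ≤ sobolevConst N s * (volume.real Ω) ^ (2 * (1 / critExp N s - 1 / q))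
        * (lpNorm u (ENNReal.ofReal (critExp N s)) volume
          * (volume.real Ω) ^ (1 / q - 1 / critExp N s)) ^ 2 := by gcongr
    _ = sobolevConst N s * lpNorm u (ENNReal.ofReal (critExp N s)) volume ^ 2 := by
        linear_combination (sobolevConst N s * lpNorm u (ENNReal.ofReal (critExp N s)) volume ^ 2) * e
    _ ≤ _ := hsob

theorem wholeSpaceConst_set_nonempty (hN : 0 < N) {s : ℝ} (hs : 0 < s) (q : ℝ) :
    {r : ℝ | ∃ u : Space N → ℝ, MemHs s u ∧ ¬ u =ᵐ[volume] 0 ∧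
      r = (‖fracLap (s / 2) u‖ ^ 2 + lpNorm u 2 volume ^ 2)
        / lpNorm u (ENNReal.ofReal q) volume ^ 2}.Nonempty :=
  ⟨_, bump s 1 0, (bump_energy hN hs one_pos 0).1, not_bump_ae_eq_zero hs one_pos 0, rfl⟩

/-- The energy is nonnegative, whence the value is at least 1. For wide bumps the energy is smaller
than the squared L² norm by a factor of order R^{-2s}. -/
theorem wholeSpaceConst_two (hN : 0 < N) {s : ℝ} (hs : 0 < s) : wholeSpaceConst N s 2 = 1 := by
  refine le_antisymm ?_ (le_csInf (wholeSpaceConst_set_nonempty hN hs 2) ?_)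
  · have hm := bumpMass_pos hN (mul_pos two_pos hs)
    have hlim : Tendsto (fun R : ℝ => bumpEnergy N s / bumpMass N (2 * s) * R ^ (-(2 * s)) + 1) atTop (𝓝 1) := by
      simpa using ((tendsto_rpow_neg_atTop (by linarith : 0 < 2 * s)).const_mul
        (bumpEnergy N s / bumpMass N (2 * s))).add_const 1
    refine ge_of_tendsto hlim ?_
    filter_upwards [eventually_gt_atTop 0] with R hR
    refine (wholeSpaceConst_le_bump hN hs two_pos hR).trans_eq ?_
    have hX : 0 < R ^ ((N : ℝ) + 4 * s) := Real.rpow_pos_of_pos hR _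
    have e : R ^ (2 * s + (N : ℝ)) = R ^ (-(2 * s)) * R ^ ((N : ℝ) + 4 * s) := by
      rw [← Real.rpow_add hR]; ring_nf
    rw [div_self two_ne_zero, Real.rpow_one, e, show 2 * (N : ℝ) / 2 + 4 * s = N + 4 * s by ring]
    field_simp
  · rintro r ⟨u, hu, hnz, rfl⟩
    have hpos := lpNorm_pos hu.1 two_ne_zero hnz
    rw [ENNReal.ofReal_ofNat, le_div_iff₀ (by positivity)]
    nlinarith [sq_nonneg ‖fracLap (s / 2) u‖]

theorem le_wholeSpaceConst {s q θ : ℝ} (hs : 0 < s) (hs1 : s < 1) (hN : 2 * s < N) (hq : 0 < q)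
    (hθ0 : 0 < θ) (hθ1 : θ < 1) (hθ : 1 / q = θ / 2 + (1 - θ) / critExp N s) :
    θ ^ (-θ) * (1 - θ) ^ (-(1 - θ)) * sobolevConst N s ^ (1 - θ) ≤ wholeSpaceConst N s q := by
  have hN' : 0 < N := by exact_mod_cast (by linarith : (0 : ℝ) < N)
  have h1 : 0 < 1 - θ := by linarith
  refine le_csInf (wholeSpaceConst_set_nonempty hN' hs q) ?_
  rintro r ⟨u, hu, hnz, rfl⟩
  rcases (sobolevConst_nonneg N s).eq_or_lt with hS | hS
  · rw [← hS, Real.zero_rpow h1.ne', mul_zero]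
    positivity
  obtain ⟨hm, hsob⟩ := sobolev_memHs hs hs1 hN hS hu
  have hle := eLpNorm_interpolation hu.1.aestronglyMeasurable two_pos (critExp_pos hs hN) hq hθ0.le hθ1.le hθ
  rw [ENNReal.ofReal_ofNat] at hle
  have hmq : MemLp u (ENNReal.ofReal q) volume := ⟨hu.1.aestronglyMeasurable, hle.trans_lt
    (ENNReal.mul_lt_top (ENNReal.rpow_lt_top_of_nonneg hθ0.le hu.1.eLpNorm_ne_top)
      (ENNReal.rpow_lt_top_of_nonneg h1.le hm.eLpNorm_ne_top))⟩
  have hpos := lpNorm_pos hmq (by simpa using hq) hnz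
  rw [← ofReal_lpNorm hmq, ← ofReal_lpNorm hm, ← ofReal_lpNorm hu.1,
    ENNReal.ofReal_rpow_of_nonneg lpNorm_nonneg hθ0.le, ENNReal.ofReal_rpow_of_nonneg lpNorm_nonneg h1.le,
    ← ENNReal.ofReal_mul (Real.rpow_nonneg lpNorm_nonneg _),
    ENNReal.ofReal_le_ofReal_iff (mul_nonneg (Real.rpow_nonneg lpNorm_nonneg _)
      (Real.rpow_nonneg lpNorm_nonneg _))] at hle
  set X := lpNorm u (ENNReal.ofReal q) volume
  set Y := lpNorm u (ENNReal.ofReal (critExp N s)) volume with hY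
  set M := lpNorm u 2 volume with hM
  set E := ‖fracLap (s / 2) u‖ ^ 2 with hE
  have hY0 : 0 ≤ Y := lpNorm_nonneg
  have hM0 : 0 ≤ M := lpNorm_nonneg
  have hE0 : 0 ≤ E := by positivity
  rw [le_div_iff₀ (by positivity)]
  have hsq : ∀ a b : ℝ, 0 ≤ a → (a ^ b) ^ 2 = (a ^ 2) ^ b := fun a b ha => by
    rw [← Real.rpow_natCast, ← Real.rpow_natCast, ← Real.rpow_mul ha, ← Real.rpow_mul ha, mul_comm]
  have hX2 : X ^ 2 ≤ (M ^ 2) ^ θ * (Y ^ 2) ^ (1 - θ) := by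
    rw [← hsq M θ hM0, ← hsq Y (1 - θ) hY0, ← mul_pow]
    exact pow_le_pow_left₀ hpos.le hle 2
  -- Dividing by the weights makes the arithmetic mean exactly M² + E and produces the factors
  -- θ^{-θ} and (1-θ)^{-(1-θ)}.
  have hamgm := Real.geom_mean_le_arith_mean2_weighted hθ0.le h1.le (p₁ := M ^ 2 / θ) (p₂ := E / (1 - θ))
    (by positivity) (by positivity) (by ring)
  rw [mul_div_cancel₀ _ hθ0.ne', mul_div_cancel₀ _ h1.ne', Real.div_rpow (by positivity) hθ0.le,
    Real.div_rpow hE0 h1.le] at hamgm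
  calc θ ^ (-θ) * (1 - θ) ^ (-(1 - θ)) * sobolevConst N s ^ (1 - θ) * X ^ 2
      ≤ θ ^ (-θ) * (1 - θ) ^ (-(1 - θ)) * sobolevConst N s ^ (1 - θ)
        * ((M ^ 2) ^ θ * (Y ^ 2) ^ (1 - θ)) := by gcongr
    _ = θ ^ (-θ) * (1 - θ) ^ (-(1 - θ)) * ((M ^ 2) ^ θ * (sobolevConst N s * Y ^ 2) ^ (1 - θ)) := by
        rw [Real.mul_rpow hS.le (by positivity)]; ring
    _ ≤ θ ^ (-θ) * (1 - θ) ^ (-(1 - θ)) * ((M ^ 2) ^ θ * E ^ (1 - θ)) := by gcongr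
    _ = (M ^ 2) ^ θ / θ ^ θ * (E ^ (1 - θ) / (1 - θ) ^ (1 - θ)) := by
        rw [Real.rpow_neg hθ0.le, Real.rpow_neg h1.le]; ring
    _ ≤ M ^ 2 + E := hamgm
    _ = E + M ^ 2 := add_comm _ _

end FracSobolev

theorem theorem1p2 (N : ℕ) (s : ℝ) (hs0 : 0 < s) (hs1 : s < 1) (hN : 2 * s < N) :
    (∀ Ω : Set (FracSobolev.Space N), IsOpen Ω → Ω.Nonempty → Bornology.IsBounded Ω →
      ∀ q : ℝ, 1 ≤ q → q < FracSobolev.critExp N s →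
        FracSobolev.sobolevConst N s
            * (MeasureTheory.volume.real Ω) ^ (2 * (1 / FracSobolev.critExp N s - 1 / q))
          ≤ FracSobolev.domainConst s q Ω ∧
        FracSobolev.domainConst s q Ω
          ≤ (2 : ℝ) ^ (2 * s + 2 / q) * (FracSobolev.unitBallVol N * N) ^ (1 - 2 / q)
              / (N + 2 * s) * Real.Gamma (s + 1) ^ 2
            * (ProbabilityTheory.beta ((N : ℝ) / 2) (q * s + 1)) ^ (-(2 / q))
            * (FracSobolev.inradius Ω) ^ (2 * N * (1 / FracSobolev.critExp N s - 1 / q))) ∧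
    FracSobolev.wholeSpaceConst N s 2 = 1 ∧
    (∀ q : ℝ, 2 < q → q < FracSobolev.critExp N s →
      (N / s * (1 / q - 1 / FracSobolev.critExp N s))
            ^ (N / s * (1 / FracSobolev.critExp N s - 1 / q))
          * (N / s * (1 / 2 - 1 / q)) ^ (N / s * (1 / q - 1 / 2))
          * (FracSobolev.sobolevConst N s) ^ (N / s * (1 / 2 - 1 / q))
        ≤ FracSobolev.wholeSpaceConst N s q ∧
      FracSobolev.wholeSpaceConst N s q
        ≤ (FracSobolev.unitBallVol N) ^ (1 - 2 / q) * s
          * ((2 : ℝ) ^ (2 * s + 1 - 2 * s / N) * Real.Gamma (s + 1) ^ 2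
              / ((N + 2 * s) * (1 / 2 - 1 / q))) ^ (N / s * (1 / 2 - 1 / q))
          * (N * ProbabilityTheory.beta ((N : ℝ) / 2) (q * s + 1)) ^ (-(2 / q))
          * (ProbabilityTheory.beta ((N : ℝ) / 2) (2 * s + 1)
              / (1 / q - 1 / FracSobolev.critExp N s))
            ^ (N / s * (1 / q - 1 / FracSobolev.critExp N s))) := by
  have hNr : (0 : ℝ) < N := by linarith
  have hN' : 0 < N := by exact_mod_cast hNr
  refine ⟨fun Ω hΩ hne hb q hq1 hq => ⟨FracSobolev.le_domainConst hs0 hs1 hN hq1 hq hΩ hne hb,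
    FracSobolev.domainConst_le hs0 hN (by linarith) hΩ hne hb⟩,
    FracSobolev.wholeSpaceConst_two hN' hs0, fun q hq2 hq => ?_⟩
  have hq0 : 0 < q := by linarith
  have hcrit := FracSobolev.one_div_critExp hN hs0
  -- This is the interpolation parameter: 1/q = θ/2 + (1 - θ)/2_s^*. All exponents in (3) are ±θ,
  -- ±(1 - θ) or involve 2/q.
  set θ : ℝ := N / s * (1 / q - 1 / FracSobolev.critExp N s) with hθ
  have hθ0 : 0 < θ := mul_pos (by positivity) (sub_pos.2 (one_div_lt_one_div_of_lt hq0 hq))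
  have h1θ : 1 - θ = N / s * (1 / 2 - 1 / q) := by
    rw [hθ, hcrit]; field_simp; ring
  have hθ1 : θ < 1 := by
    have : 0 < 1 - θ := by
      rw [h1θ]
      exact mul_pos (by positivity) (sub_pos.2 (one_div_lt_one_div_of_lt two_pos hq2))
    linarith
  have e1 : N / s * (1 / FracSobolev.critExp N s - 1 / q) = -θ := by rw [hθ]; ring
  have e2 : N / s * (1 / q - 1 / 2) = -(1 - θ) := by rw [h1θ]; ring
  have e3 : 1 / 2 - 1 / q = (1 - θ) * s / N := by rw [h1θ]; field_simp
  have e4 : 1 / q - 1 / FracSobolev.critExp N s = θ * s / N := by rw [hθ]; field_simp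
  rw [e1, e2, ← h1θ, e3, e4]
  constructor
  · refine FracSobolev.le_wholeSpaceConst hs0 hs1 hN hq0 hθ0 hθ1 ?_
    have h5 : 1 / q = 1 / 2 - (1 - θ) * s / N := by linarith
    rw [div_eq_mul_one_div (1 - θ), hcrit, h5]
    ring
  · have hrel : N * (1 - 2 / q) = 2 * s * (1 - θ) := by rw [h1θ]; field_simp
    rw [← FracSobolev.wholeSpace_bound_eq hN' hs0 hq0 hθ0 hθ1 hrel]
    obtain ⟨R, hR, hval⟩ := FracSobolev.exists_optimal_radius hs0 (FracSobolev.bumpEnergy_pos hN' hs0)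
      (FracSobolev.bumpMass_pos hN' (mul_pos two_pos hs0))
      (Real.rpow_pos_of_pos (FracSobolev.bumpMass_pos hN' (mul_pos hq0 hs0)) (2 / q)) hθ0 hθ1 hrel
    rw [← hval]
    exact FracSobolev.wholeSpaceConst_le_bump hN' hs0 hq0 hR
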